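/- Let $Q(x,y)=ax^2+bxy+cy^2+dx+ey+f$ with real coefficients define a non-degenerate conic (that is, the symmetric $3\times 3$ matrix of $Q$ is invertible) that is not a circumference (that is, not both $a=c$ and $b=0$). Let $\Gamma=\{(x,y)\in\mathbb{R}^2 : Q(x,y)=0\}$ and let $D$ be the region enclosed by $\Gamma$, that is, the union of the bounded connected components of $\mathbb{R}^2\setminus\Gamma$; it is assumed that $\Gamma$ does enclose a region, i.e. $D\neq\emptyset$ (so $\Gamma$ is an ellipse). Identify $\mathbb{R}^2$ with $\mathbb{C}$ by $z=x+iy$ and put $\frac{\partial}{\partial\bar z}=\frac12\left(\frac{\partial}{\partial x}+i\frac{\partial}{\partial y}\right)$. Let $P$ be a polynomial in $x$ and $y$ with complex coefficients, let $q>2$ ($q=\infty$ allowed), let $A\in W^{1,q}(D)$ be complex-valued, and put $$T_D[A](z)=-\frac1\pi\iint_D\frac{A(\zeta)}{\zeta-z}\,d\xi\,d\eta,\qquad \zeta=\xi+i\eta .$$ Then the Dirichlet problem $$\left(\frac{\partial}{\partial\bar z}-A\right)^2w=0\ \text{ in } D,\qquad w=e^{T_D[A]}P\ \text{ on }\Gamma,$$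 has a unique solution $w\in C(\overline D)$. Here the equation is understood in the weak sense: there is $u\in L^1_{\mathrm{loc}}(D)$ such that $\frac{\partial w}{\partial\bar z}=Aw+u$ and $\frac{\partial u}{\partial\bar z}=Au$ in $D$ in the sense of distributions, where the right-hand sides are locally integrable. -/

import Mathlib

open MeasureTheory
open scoped ContDiff ENNReal

namespace VekuaBitsadze

/-! The plane `ℝ²` is identified with `ℂ` throughout, `z = x + i y`. -/

/-- The coefficients of a real quadratic equation
`Q(x, y) = a x² + b x y + c y² + d x + e y + f = 0`. -/
structure Conic where
  a : ℝ
  b : ℝ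
  c : ℝ
  d : ℝ
  e : ℝ
  f : ℝ

namespace Conic

/-- The quadratic polynomial `Q(x, y)`. -/
def eval (Q : Conic) (x y : ℝ) : ℝ :=
  Q.a * x ^ 2 + Q.b * x * y + Q.c * y ^ 2 + Q.d * x + Q.e * y + Q.f

/-- The curve `Γ = {(x, y) : Q(x, y) = 0}`. -/
def curve (Q : Conic) : Set ℂ := {z | Q.eval z.re z.im = 0}

/-- The symmetric matrix of the homogenized quadratic form. -/
noncomputable def matrix (Q : Conic) : Matrix (Fin 3) (Fin 3) ℝ :=
  !![Q.a, Q.b / 2, Q.d / 2;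
     Q.b / 2, Q.c, Q.e / 2;
     Q.d / 2, Q.e / 2, Q.f]

/-- A conic is non-degenerate if its `3 × 3` matrix is invertible. (In particular the quadratic
part is then nonzero.) -/
def NonDegenerate (Q : Conic) : Prop := Q.matrix.det ≠ 0

/-- The equation of a circumference: `a = c` and `b = 0`. -/
def IsCircumference (Q : Conic) : Prop := Q.a = Q.c ∧ Q.b = 0

end Conic

/-- The region enclosed by a set `Γ` of the plane: the union of the bounded connected components
of its complement. -/
def enclosedRegion (Γ : Set ℂ) : Set ℂ :=
  {z | z ∉ Γ ∧ Bornology.IsBounded (connectedComponentIn Γᶜ z)}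

/-- The value at the point `z = x + i y` of a polynomial in `x` and `y` with complex
coefficients. -/
noncomputable def polyEval (P : MvPolynomial (Fin 2) ℂ) (z : ℂ) : ℂ :=
  MvPolynomial.eval ![(z.re : ℂ), (z.im : ℂ)] P

/-- `φ` is a test function on `D`: complex-valued, (real) smooth, with compact support
contained in `D`. -/
def IsTestFunction (D : Set ℂ) (φ : ℂ → ℂ) : Prop :=
  ContDiff ℝ ∞ φ ∧ HasCompactSupport φ ∧ tsupport φ ⊆ D

/-- `∂φ/∂z̄ = (1/2) (∂φ/∂x + i ∂φ/∂y)` for a (real) differentiable function `φ`. -/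
noncomputable def dbar (φ : ℂ → ℂ) (z : ℂ) : ℂ :=
  (1 / 2) * (fderiv ℝ φ z 1 + Complex.I * fderiv ℝ φ z Complex.I)

/-- On `D`, the locally integrable function `g` is the weak derivative of the locally integrable
function `f` in the direction `v` (`v = 1` for `∂/∂x` and `v = i` for `∂/∂y`). -/
def HasWeakDeriv (D : Set ℂ) (v : ℂ) (f g : ℂ → ℂ) : Prop :=
  LocallyIntegrableOn f D ∧ LocallyIntegrableOn g D ∧
    ∀ φ : ℂ → ℂ, IsTestFunction D φ →
      ∫ z in D, f z * fderiv ℝ φ z v = - ∫ z in D, g z * φ z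

/-- On `D`, the locally integrable function `g` is the weak derivative `∂f/∂z̄` of the locally
integrable function `f`. -/
def HasWeakDbar (D : Set ℂ) (f g : ℂ → ℂ) : Prop :=
  LocallyIntegrableOn f D ∧ LocallyIntegrableOn g D ∧
    ∀ φ : ℂ → ℂ, IsTestFunction D φ →
      ∫ z in D, f z * dbar φ z = - ∫ z in D, g z * φ z

/-- The Sobolev space `W^{1,q}(D)`: `f` and its weak first partial derivatives are in
`L^q(D)`. -/
def MemW1 (D : Set ℂ) (q : ℝ≥0∞) (f : ℂ → ℂ) : Prop :=
  MemLp f q (volume.restrict D) ∧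
    ∃ fx fy : ℂ → ℂ,
      MemLp fx q (volume.restrict D) ∧ MemLp fy q (volume.restrict D) ∧
      HasWeakDeriv D 1 f fx ∧ HasWeakDeriv D Complex.I f fy

/-- The Vekua (Cauchy–Pompeiu–Teodorescu) operator
`T_D[A](z) = -(1/π) ∬_D A(ζ) / (ζ - z) dξ dη`, `ζ = ξ + i η`. -/
noncomputable def vekuaT (D : Set ℂ) (A : ℂ → ℂ) (z : ℂ) : ℂ :=
  -(1 / (Real.pi : ℂ)) * ∫ ζ in D, A ζ / (ζ - z)

/-- `w` solves `(∂/∂z̄ - A)² w = 0` in `D`, in the weak sense: `u = (∂/∂z̄ - A) w` exists as a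
locally integrable function, that is `∂w/∂z̄ = A w + u`, and `(∂/∂z̄ - A) u = 0`. -/
def SolvesVekuaBitsadze (D : Set ℂ) (A w : ℂ → ℂ) : Prop :=
  ∃ u : ℂ → ℂ,
    HasWeakDbar D w (fun z => A z * w z + u z) ∧ HasWeakDbar D u (fun z => A z * u z)

/-- `w` solves the Dirichlet problem `(∂/∂z̄ - A)² w = 0` in `D`, `w = g` on `Γ`; it is continuous
up to the boundary, so that its boundary values are meant pointwise. -/
def IsDirichletSolution (D Γ : Set ℂ) (A g w : ℂ → ℂ) : Prop :=
  ContinuousOn w (closure D) ∧ SolvesVekuaBitsadze D A w ∧ ∀ z ∈ Γ, w z = g z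

end VekuaBitsadze

open VekuaBitsadze

namespace VekuaBitsadze
open Set Filter Topology Metric ComplexConjugate

/-! ### The Cauchy kernel -/

/-! The factor `e^{-T_D A}` removes `A`: since `T_D` inverts `∂/∂z̄`, the function `e^{-T_D A} w`
solves `∂²V/∂z̄² = 0` exactly when `w` solves the given equation. This is
`HasWeakDbar.integratingFactor`, proved for smooth coefficients and carried to `L^q`, `q > 2`, by
approximation; it rests on the Cauchy–Pompeiu formula `vekuaT_dbar` and on `continuous_vekuaT`. By
Weyl's lemma, the continuous solutions of the reduced equation are the bianalytic functions `z̄ f +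
g` (`bianalytic_of_weak`). What remains is a Dirichlet problem for these with polynomial data.

Existence is algebraic. In the variables `z, z̄` the conic is `α z̄² + B(z) z̄ + C(z) = 0`, and `α ≠
0` precisely because it is not a circumference. On `Γ` every power of `z̄` therefore reduces to
degree at most one, and `P = z̄ f + g` there with `f`, `g` entire (`Conic.exists_bianalytic_eq`).

Uniqueness (`bianalytic_eq_zero`) concerns `V = z̄ f + g`, continuous and zero on the boundary of an
ellipse. The map `ζ ↦ c + p ζ + s / ζ` covers the ellipse twice by the annulus `|s| / |p| < |ζ| <
1`, with `|ζ| = 1` lying over `Γ`. On that circle `z̄` coincides with a rational function `S(ζ)`,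
the Schwarz function. Let `F = S f + g`, with `f` and `g` taken at the image point; it is
holomorphic on the annulus. An interior estimate for `f` shows that `F` tends to zero at the outer
circle, so `F = 0`. The points `ζ` and `s / (p ζ)` lie over the same `z` but give different values
of `S`, except over the foci; two linear equations then force `f(z) = g(z) = 0`. A disc has `s = 0`
and no second sheet, and there `1 - |z|²` violates uniqueness. -/

theorem integrableOn_norm_rpow_neg_ball {s : ℝ} (hs : s < 2) (r : ℝ) :
    IntegrableOn (fun w : ℂ => ‖w‖ ^ (-s)) (ball 0 r) := by
  rw [integrableOn_fun_norm_addHaar (μ := (volume : Measure ℂ)) (f := fun y : ℝ => y ^ (-s))]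
  rcases le_or_gt r 0 with hr | hr
  · simp [Ioo_eq_empty_of_le hr]
  -- The Jacobian of polar coordinates turns `y ^ (-s)` into `y ^ (1 - s)`, integrable at `0` as `1
  -- - s > -1`.
  have h := (intervalIntegral.intervalIntegrable_rpow' (a := 0) (b := r) (r := 1 - s)
    (by linarith)).1
  refine ((h.mono_set Ioo_subset_Ioc_self).congr_fun (fun y hy => ?_) measurableSet_Ioo)
  simp only [Complex.finrank_real_complex, smul_eq_mul]
  rw [sub_eq_add_neg, Real.rpow_add hy.1]
  simp

theorem integrableOn_inv_ball (r : ℝ) : IntegrableOn (fun w : ℂ => w⁻¹) (ball 0 r) := by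
  have h := integrableOn_norm_rpow_neg_ball (s := 1) (by norm_num) r
  refine h.mono' (by fun_prop) (Eventually.of_forall fun w => ?_)
  rw [Real.rpow_neg_one, norm_inv]

theorem locallyIntegrable_inv : LocallyIntegrable (fun w : ℂ => w⁻¹) := by
  rw [locallyIntegrable_iff]
  intro k hk
  obtain ⟨r, hr⟩ := hk.isBounded.subset_ball 0
  exact (integrableOn_inv_ball r).mono_set hr

theorem fderiv_eq_re_im (f : ℂ → ℂ) (z v : ℂ) :
    fderiv ℝ f z v = v.re * fderiv ℝ f z 1 + v.im * fderiv ℝ f z Complex.I := by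
  conv_lhs => rw [show v = v.re • (1 : ℂ) + v.im • Complex.I by
    simp [Complex.re_add_im]]
  rw [map_add, map_smul, map_smul]; simp

/-- Gives access to the smoothness and differentiation theorems for convolutions; the minus sign is
absorbed by `ζ - z = -(z - ζ)`. -/
theorem vekuaT_univ_eq_convolution (f : ℂ → ℂ) (z : ℂ) :
    vekuaT univ f z = (1 / (Real.pi : ℂ)) *
      convolution f (fun w : ℂ => w⁻¹) (ContinuousLinearMap.mul ℝ ℂ) volume z := by
  rw [vekuaT, convolution, setIntegral_univ, neg_mul, ← mul_neg, ← integral_neg]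
  congr 2; ext ζ
  rw [ContinuousLinearMap.mul_apply', ← div_eq_mul_inv, ← neg_sub ζ z, div_neg]

theorem contDiff_vekuaT {f : ℂ → ℂ} (hf : ContDiff ℝ ∞ f) (hc : HasCompactSupport f) :
    ContDiff ℝ ∞ (vekuaT univ f) := by
  rw [funext (vekuaT_univ_eq_convolution f)]
  exact contDiff_const.mul
    (hc.contDiff_convolution_left (n := ⊤) _ hf locallyIntegrable_inv)

theorem integrable_mul_inv_sub {f : ℂ → ℂ} (hf : Continuous f) (hc : HasCompactSupport f) (z : ℂ) :
    Integrable (fun ζ => f ζ / (ζ - z)) := by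
  have h : LocallyIntegrable (fun ζ : ℂ => (ζ - z)⁻¹) := by
    have := (locallyIntegrable_map_homeomorph (μ := volume) (Homeomorph.subRight z)
      (f := fun w : ℂ => w⁻¹)).1 (by
        have hm : Measure.map (Homeomorph.subRight z) (volume : Measure ℂ) = volume :=
          (measurePreserving_sub_right volume z).map_eq
        rw [hm]; exact locallyIntegrable_inv)
    exact this
  simpa [div_eq_mul_inv] using h.integrable_smul_left_of_hasCompactSupport hf hc

theorem fderiv_vekuaT {f : ℂ → ℂ} (hf : ContDiff ℝ ∞ f) (hc : HasCompactSupport f) (z v : ℂ) :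
    fderiv ℝ (vekuaT univ f) z v = vekuaT univ (fun ζ => fderiv ℝ f ζ v) z := by
  have h := hc.hasFDerivAt_convolution_left (ContinuousLinearMap.mul ℝ ℂ)
    (hf.of_le (by simp)) locallyIntegrable_inv z
  have h2 := h.const_mul (1 / (Real.pi : ℂ))
  rw [← funext (vekuaT_univ_eq_convolution f)] at h2
  rw [h2.fderiv, vekuaT_univ_eq_convolution]
  simp only [smul_apply, smul_eq_mul]
  congr 1
  rw [convolution, convolution, ContinuousLinearMap.integral_apply]
  · simp [ContinuousLinearMap.precompL, mul_comm]
  · exact (hc.fderiv ℝ).convolutionExists_left _ (hf.continuous_fderiv (by simp))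
      locallyIntegrable_inv z

theorem continuous_dbar {f : ℂ → ℂ} (hf : ContDiff ℝ ∞ f) : Continuous (dbar f) := by
  have h := hf.continuous_fderiv (by simp)
  unfold dbar
  fun_prop

theorem dbar_vekuaT_eq_vekuaT_dbar {f : ℂ → ℂ} (hf : ContDiff ℝ ∞ f) (hc : HasCompactSupport f) (z : ℂ) :
    dbar (vekuaT univ f) z = vekuaT univ (dbar f) z := by
  have h1 : ∀ v, Integrable (fun ζ => fderiv ℝ f ζ v / (ζ - z)) := fun v =>
    integrable_mul_inv_sub ((hf.continuous_fderiv (by simp)).clm_apply continuous_const)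
      (hc.fderiv_apply ℝ v) z
  rw [dbar, fderiv_vekuaT hf hc, fderiv_vekuaT hf hc]
  simp only [vekuaT, setIntegral_univ, dbar]
  have : ∀ ζ, 1 / 2 * (fderiv ℝ f ζ 1 + Complex.I * fderiv ℝ f ζ Complex.I) / (ζ - z)
    = (1 / 2) * (fderiv ℝ f ζ 1 / (ζ - z)) + (Complex.I / 2) *
      (fderiv ℝ f ζ Complex.I / (ζ - z)) := fun ζ => by ring
  simp_rw [this]
  rw [integral_add ((h1 _).const_mul _) ((h1 _).const_mul _), integral_const_mul,
    integral_const_mul]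
  ring

/-! ### The Cauchy–Pompeiu formula -/

section

/-- The point `e^{iθ}` of the unit circle. -/
noncomputable def circlePt (θ : ℝ) : ℂ := Real.cos θ + Real.sin θ * Complex.I

theorem continuous_circlePt : Continuous circlePt := by unfold circlePt; fun_prop

theorem norm_circlePt (θ : ℝ) : ‖circlePt θ‖ = 1 := by
  rw [circlePt, Complex.ofReal_cos, Complex.ofReal_sin, ← Complex.exp_mul_I,
    Complex.norm_exp_ofReal_mul_I]

theorem hasDerivAt_circlePt (θ : ℝ) : HasDerivAt circlePt (Complex.I * circlePt θ) θ := by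
  have h := ((Real.hasDerivAt_cos θ).ofReal_comp).add
    (((Real.hasDerivAt_sin θ).ofReal_comp).mul_const Complex.I)
  refine h.congr_deriv ?_
  unfold circlePt
  push_cast
  linear_combination (-Complex.sin θ) * Complex.I_mul_I

/-- The polar form of the operator: a radial derivative plus `i` times a tangential one. The two are
integrated separately in `vekuaT_dbar`. -/
theorem dbar_div_circlePt (f : ℂ → ℂ) (w : ℂ) (θ : ℝ) :
    dbar f w / circlePt θ =
      (1 / 2) * fderiv ℝ f w (circlePt θ) +
        (Complex.I / 2) * fderiv ℝ f w (Complex.I * circlePt θ) := by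
  have h0 : circlePt θ ≠ 0 := norm_ne_zero_iff.1 (by rw [norm_circlePt]; norm_num)
  rw [div_eq_iff h0, fderiv_eq_re_im f w (circlePt θ),
    fderiv_eq_re_im f w (Complex.I * circlePt θ), dbar]
  have h1 : (circlePt θ).re = Real.cos θ := by
    simp [circlePt, -Complex.ofReal_cos, -Complex.ofReal_sin]
  have h2 : (circlePt θ).im = Real.sin θ := by
    simp [circlePt, -Complex.ofReal_cos, -Complex.ofReal_sin]
  simp only [Complex.mul_re, Complex.mul_im, Complex.I_re, Complex.I_im, h1, h2]
  have hcs := Complex.cos_sq_add_sin_sq θ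
  unfold circlePt
  push_cast
  have hI := Complex.I_sq
  generalize fderiv ℝ f w 1 = X
  generalize fderiv ℝ f w Complex.I = Y
  generalize Complex.cos θ = c at *
  generalize Complex.sin θ = s at *
  generalize Complex.I = i at *
  linear_combination (-X / 2 - i * Y / 2) * hcs + (X * s ^ 2 / 2 - Y * s * c / 2) * hI

theorem polar_integrable {g : ℝ × ℝ → ℂ} (hg : Continuous g) {R : ℝ}
    (hR : ∀ p : ℝ × ℝ, R < p.1 → g p = 0) :
    IntegrableOn g (Ioi (0 : ℝ) ×ˢ Ioo (-Real.pi) Real.pi) := by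
  have h1 : IntegrableOn g (Icc (0 : ℝ) R ×ˢ Icc (-Real.pi) Real.pi) :=
    hg.continuousOn.integrableOn_compact (isCompact_Icc.prod isCompact_Icc)
  refine h1.of_forall_sdiff_eq_zero (measurableSet_Ioi.prod measurableSet_Ioo) fun p hp => hR p ?_
  by_contra hle
  exact hp.2 ⟨⟨hp.1.1.le, not_lt.1 hle⟩, hp.1.2.1.le, hp.1.2.2.le⟩

variable {f : ℂ → ℂ}

theorem integral_radial (hf : ContDiff ℝ ∞ f) (hc : HasCompactSupport f) (z : ℂ) (θ : ℝ) :
    ∫ r in Ioi (0 : ℝ), fderiv ℝ f (z + r * circlePt θ) (circlePt θ) = - f z := by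
  have hd : ∀ r : ℝ, HasDerivAt (fun r : ℝ => f (z + r * circlePt θ))
      (fderiv ℝ f (z + r * circlePt θ) (circlePt θ)) r := fun r => by
    have h1 : HasDerivAt (fun r : ℝ => z + r * circlePt θ) (circlePt θ) r := by
      simpa using ((hasDerivAt_id r).ofReal_comp.mul_const (circlePt θ)).const_add z
    exact ((hf.differentiable (by simp)).differentiableAt.hasFDerivAt).comp_hasDerivAt r h1
  have h0 : circlePt θ ≠ 0 := norm_ne_zero_iff.1 (by rw [norm_circlePt]; norm_num)
  have hemb : IsClosedEmbedding (fun r : ℝ => z + r * circlePt θ) := by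
    have h1 : IsClosedEmbedding (fun w : ℂ => z + w * circlePt θ) :=
      ((Homeomorph.mulRight₀ _ h0).trans (Homeomorph.addLeft z)).isClosedEmbedding
    exact h1.comp Complex.isometry_ofReal.isClosedEmbedding
  have hcs : HasCompactSupport (fun r : ℝ => f (z + r * circlePt θ)) := hc.comp_isClosedEmbedding hemb
  have hC1 : ContDiff ℝ 1 (fun r : ℝ => f (z + r * circlePt θ)) :=
    (hf.of_le (by simp)).comp (contDiff_const.add (Complex.ofRealCLM.contDiff.mul contDiff_const))
  have := hcs.integral_Ioi_deriv_eq hC1 0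
  simpa [funext fun r => (hd r).deriv] using this

theorem integral_angular (hf : ContDiff ℝ ∞ f) (z : ℂ) {r : ℝ} (hr : 0 < r) :
    ∫ θ in Ioo (-Real.pi) Real.pi,
      fderiv ℝ f (z + r * circlePt θ) (Complex.I * circlePt θ) = 0 := by
  have hd : ∀ θ : ℝ, HasDerivAt (fun θ : ℝ => f (z + r * circlePt θ))
      (r * fderiv ℝ f (z + r * circlePt θ) (Complex.I * circlePt θ)) θ := fun θ => by
    have h1 : HasDerivAt (fun θ : ℝ => z + r * circlePt θ) (r • (Complex.I * circlePt θ)) θ := by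
      simpa using ((hasDerivAt_circlePt θ).const_mul (r : ℂ)).const_add z
    have := ((hf.differentiable (by simp)).differentiableAt.hasFDerivAt).comp_hasDerivAt θ h1
    rw [map_smul, Complex.real_smul] at this
    exact this
  have hcont : Continuous fun θ : ℝ =>
      (r * fderiv ℝ f (z + r * circlePt θ) (Complex.I * circlePt θ) : ℂ) := by
    have h1 := hf.continuous_fderiv (by simp)
    have h2 := continuous_circlePt
    have : Continuous fun θ : ℝ => fderiv ℝ f (z + r * circlePt θ) := h1.comp (by fun_prop)
    exact continuous_const.mul (this.clm_apply (by fun_prop))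
  have h := intervalIntegral.integral_eq_sub_of_hasDerivAt (a := -Real.pi) (b := Real.pi)
    (fun θ _ => hd θ) (hcont.intervalIntegrable _ _)
  rw [intervalIntegral.integral_of_le (by linarith [Real.pi_pos]), integral_Ioc_eq_integral_Ioo,
    integral_const_mul] at h
  have hp : circlePt (-Real.pi) = circlePt Real.pi := by simp [circlePt]
  rw [hp, sub_self] at h
  exact (mul_eq_zero.1 h).resolve_left (by exact_mod_cast hr.ne')

/-- The **Cauchy–Pompeiu formula** for test functions. -/
theorem vekuaT_dbar (hf : ContDiff ℝ ∞ f) (hc : HasCompactSupport f) (z : ℂ) :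
    vekuaT univ (dbar f) z = f z := by
  have hpi : (Real.pi : ℂ) ≠ 0 := by exact_mod_cast Real.pi_ne_zero
  suffices h : ∫ ζ, dbar f ζ / (ζ - z) = - Real.pi * f z by
    rw [vekuaT, setIntegral_univ, h]; field_simp
  have e1 : ∫ ζ, dbar f ζ / (ζ - z) = ∫ w, dbar f (z + w) / w := by
    rw [← integral_add_left_eq_self (fun ζ => dbar f ζ / (ζ - z)) z]; simp
  rw [e1, ← Complex.integral_comp_polarCoord_symm, polarCoord_target]
  obtain ⟨R, hR⟩ := hc.isCompact.isBounded.subset_ball z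
  have hz : ∀ r θ : ℝ, R < r → fderiv ℝ f (z + r * circlePt θ) = 0 := fun r θ hr => by
    apply image_eq_zero_of_notMem_tsupport
    intro hmem
    have := hR (tsupport_fderiv_subset ℝ hmem)
    rw [mem_ball, dist_eq_norm, add_sub_cancel_left, norm_mul, norm_circlePt,
      Complex.norm_real, Real.norm_eq_abs, mul_one] at this
    exact absurd (le_abs_self r) (by linarith)
  have hcF : Continuous fun p : ℝ × ℝ => fderiv ℝ f (z + p.1 * circlePt p.2) := by
    have h1 := hf.continuous_fderiv (by simp)
    have h2 := continuous_circlePt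
    exact h1.comp (by fun_prop)
  have hc2 : Continuous fun p : ℝ × ℝ => circlePt p.2 := continuous_circlePt.comp continuous_snd
  have i1 := polar_integrable (R := R)
    (g := fun p : ℝ × ℝ => fderiv ℝ f (z + p.1 * circlePt p.2) (circlePt p.2))
    (hcF.clm_apply hc2) (fun p hp => by simp [hz p.1 p.2 hp])
  have i2 := polar_integrable (R := R)
    (g := fun p : ℝ × ℝ => fderiv ℝ f (z + p.1 * circlePt p.2) (Complex.I * circlePt p.2))
    (hcF.clm_apply (continuous_const.mul hc2)) (fun p hp => by simp [hz p.1 p.2 hp])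
  have e2 : ∫ p in Ioi (0 : ℝ) ×ˢ Ioo (-Real.pi) Real.pi,
      p.1 • (dbar f (z + Complex.polarCoord.symm p) / Complex.polarCoord.symm p) =
      ∫ p in Ioi (0 : ℝ) ×ˢ Ioo (-Real.pi) Real.pi,
        ((1 / 2) * fderiv ℝ f (z + p.1 * circlePt p.2) (circlePt p.2) +
        (Complex.I / 2) * fderiv ℝ f (z + p.1 * circlePt p.2) (Complex.I * circlePt p.2)) := by
    refine setIntegral_congr_fun (measurableSet_Ioi.prod measurableSet_Ioo) fun p hp => ?_
    have hp1 : (p.1 : ℂ) ≠ 0 := by exact_mod_cast (ne_of_gt hp.1)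
    simp only [← dbar_div_circlePt, Complex.polarCoord_symm_apply]
    change _ • (dbar f (z + p.1 * circlePt p.2) / (p.1 * circlePt p.2)) = _
    rw [Complex.real_smul]; field_simp
  rw [e2, integral_add (i1.const_mul _) (i2.const_mul _), integral_const_mul, integral_const_mul]
  -- Tangential part: for fixed `r` the integrand is, up to the factor `r`, the derivative of a
  -- periodic function of `θ`.
  have e3 : ∫ p in Ioi (0 : ℝ) ×ˢ Ioo (-Real.pi) Real.pi,
      fderiv ℝ f (z + p.1 * circlePt p.2) (Complex.I * circlePt p.2) = 0 := by
    rw [Measure.volume_eq_prod, setIntegral_prod _ i2]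
    exact setIntegral_eq_zero_of_forall_eq_zero fun r hr => integral_angular hf z hr
  -- Radial part: each ray contributes `-f z`, hence the order of integration is exchanged to
  -- integrate in `r` first.
  have e4 : ∫ p in Ioi (0 : ℝ) ×ˢ Ioo (-Real.pi) Real.pi,
      fderiv ℝ f (z + p.1 * circlePt p.2) (circlePt p.2) = - (2 * Real.pi) * f z := by
    rw [Measure.volume_eq_prod, ← setIntegral_prod_swap,
      setIntegral_prod (fun p : ℝ × ℝ => fderiv ℝ f (z + p.swap.1 * circlePt p.swap.2)
        (circlePt p.swap.2)) i1.swap]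
    simp only [Prod.fst_swap, Prod.snd_swap, integral_radial hf hc]
    rw [setIntegral_const]
    simp only [measureReal_def, Real.volume_Ioo, Complex.real_smul]
    rw [ENNReal.toReal_ofReal (by linarith [Real.pi_pos])]
    push_cast
    ring
  rw [e3, e4]; ring

theorem dbar_vekuaT (hf : ContDiff ℝ ∞ f) (hc : HasCompactSupport f) (z : ℂ) :
    dbar (vekuaT univ f) z = f z := by
  rw [dbar_vekuaT_eq_vekuaT_dbar hf hc, vekuaT_dbar hf hc]

end

/-! ### Boundedness and continuity of the Vekua operator -/

/-- Young's inequality for `(η a) (η w)⁻¹`, with the factors `1/p` and `1/s` dropped. The free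
weight `η` lets the contribution of `A` be made small independently of the kernel's. -/
theorem div_le_young {p s : ℝ} (hps : p.HolderConjugate s) {η a w : ℝ} (hη : 0 < η)
    (ha : 0 ≤ a) (hw : 0 ≤ w) :
    a / w ≤ η ^ p * a ^ p + η ^ (-s) * w ^ (-s) := by
  have h := Real.young_inequality_of_nonneg (a := η * a) (b := (η * w)⁻¹) (by positivity)
    (by positivity) hps
  have h1 : η * a * (η * w)⁻¹ = a / w := by
    rw [mul_inv]; field_simp
  rw [h1, Real.mul_rpow hη.le ha, ← Real.rpow_neg_one, ← Real.rpow_mul (by positivity),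
    neg_one_mul, Real.mul_rpow hη.le hw] at h
  refine h.trans (add_le_add ?_ ?_)
  · exact div_le_self (by positivity) hps.lt.le
  · exact div_le_self (by positivity) hps.symm.lt.le

theorem lp_kernel_integral_le {D : Set ℂ} {A : ℂ → ℂ} {p s : ℝ} (hps : p.HolderConjugate s)
    (hs : s < 2) (hA : MemLp A (ENNReal.ofReal p) (volume.restrict D))
    {η : ℝ} (hη : 0 < η) (δ : ℝ) (z : ℂ) :
    Integrable (fun ζ => (ball (0 : ℂ) δ).indicator (fun w => ‖w‖⁻¹) (ζ - z) * ‖A ζ‖)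
      (volume.restrict D) ∧
    ∫ ζ in D, (ball (0 : ℂ) δ).indicator (fun w => ‖w‖⁻¹) (ζ - z) * ‖A ζ‖ ≤
      η ^ p * (∫ ζ in D, ‖A ζ‖ ^ p) + η ^ (-s) * ∫ w in ball (0 : ℂ) δ, ‖w‖ ^ (-s) := by
  have hp0 : 0 < p := hps.pos
  have hAp : Integrable (fun ζ => ‖A ζ‖ ^ p) (volume.restrict D) := by
    have := hA.integrable_norm_rpow (by simpa using hp0) (by simp)
    rwa [ENNReal.toReal_ofReal hp0.le] at this
  set k : ℂ → ℝ := (ball (0 : ℂ) δ).indicator (fun w => ‖w‖ ^ (-s)) with hk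
  have hk0 : ∀ w, 0 ≤ k w := fun w => indicator_nonneg (fun _ _ => by positivity) _
  have hki : Integrable k := (integrable_indicator_iff measurableSet_ball).2
    (integrableOn_norm_rpow_neg_ball hs δ)
  have hkz : Integrable (fun ζ => k (ζ - z)) := hki.comp_sub_right z
  have hle : ∀ ζ, (ball (0 : ℂ) δ).indicator (fun w => ‖w‖⁻¹) (ζ - z) * ‖A ζ‖ ≤
      η ^ p * ‖A ζ‖ ^ p + η ^ (-s) * k (ζ - z) := fun ζ => by
    by_cases h : ζ - z ∈ ball (0 : ℂ) δ
    · rw [hk, indicator_of_mem h, indicator_of_mem h, mul_comm, ← div_eq_mul_inv]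
      exact div_le_young hps hη (norm_nonneg _) (norm_nonneg _)
    · rw [hk, indicator_of_notMem h, indicator_of_notMem h]; simp; positivity
  have hb : Integrable (fun ζ => η ^ p * ‖A ζ‖ ^ p + η ^ (-s) * k (ζ - z)) (volume.restrict D) :=
    (hAp.const_mul _).add ((hkz.integrableOn (s := D)).const_mul _)
  have hi : Integrable (fun ζ => (ball (0 : ℂ) δ).indicator (fun w => ‖w‖⁻¹) (ζ - z) * ‖A ζ‖)
      (volume.restrict D) := by
    refine hb.mono' ?_ (Eventually.of_forall fun ζ => ?_)
    · have hm : Measurable ((ball (0 : ℂ) δ).indicator (fun w : ℂ => ‖w‖⁻¹)) :=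
        (by fun_prop : Measurable fun w : ℂ => ‖w‖⁻¹).indicator measurableSet_ball
      exact (hm.comp (measurable_id.sub_const z)).aestronglyMeasurable.mul
        hA.aestronglyMeasurable.norm
    · rw [Real.norm_of_nonneg]
      · exact hle ζ
      · exact mul_nonneg (indicator_nonneg (fun _ _ => by positivity) _) (norm_nonneg _)
  refine ⟨hi, (integral_mono hi hb hle).trans ?_⟩
  rw [integral_add (hAp.const_mul _) ((hkz.integrableOn (s := D)).const_mul _),
    integral_const_mul, integral_const_mul]
  gcongr
  refine (setIntegral_le_integral hkz (Eventually.of_forall fun ζ => hk0 _)).trans ?_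
  rw [integral_sub_right_eq_self k z, hk, integral_indicator measurableSet_ball]

/-- Passing to a finite `p` strictly between `2` and `q` also covers `q = ∞`; `p > 2` means that the
conjugate exponent is below `2`, so `‖w‖ ^ (-s)` is locally integrable in the plane. -/
theorem exists_holderConjugate_memLp {D : Set ℂ} {A : ℂ → ℂ} {q : ℝ≥0∞} (hq : 2 < q)
    (hD : volume D ≠ ⊤) (hA : MemLp A q (volume.restrict D)) :
    ∃ p s : ℝ, p.HolderConjugate s ∧ s < 2 ∧ MemLp A (ENNReal.ofReal p) (volume.restrict D) := by
  have : IsFiniteMeasure (volume.restrict D) := ⟨by simpa using hD.lt_top⟩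
  obtain ⟨p, -, h2p, hpq⟩ := ENNReal.lt_iff_exists_real_btwn.1 hq
  have h2 : 2 < p := by
    rw [show (2 : ℝ≥0∞) = ENNReal.ofReal 2 by simp] at h2p
    exact (ENNReal.ofReal_lt_ofReal_iff_of_nonneg (by norm_num)).1 h2p
  refine ⟨p, p.conjExponent, Real.HolderConjugate.conjExponent (by linarith), ?_,
    hA.mono_exponent hpq.le⟩
  rw [Real.conjExponent, div_lt_iff₀ (by linarith)]
  linarith

theorem tendsto_kernel_integral {s : ℝ} (hs : s < 2) :
    Tendsto (fun n : ℕ => ∫ w in ball (0 : ℂ) (1 / (n + 1 : ℝ)), ‖w‖ ^ (-s)) atTop (𝓝 0) := by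
  have h := tendsto_setIntegral_of_antitone (μ := (volume : Measure ℂ))
    (s := fun n : ℕ => ball (0 : ℂ) (1 / (n + 1 : ℝ))) (f := fun w => ‖w‖ ^ (-s))
    (fun _ => measurableSet_ball)
    (fun m n hmn => ball_subset_ball (by gcongr))
    ⟨0, integrableOn_norm_rpow_neg_ball hs _⟩
  have he : ⋂ n : ℕ, ball (0 : ℂ) (1 / (n + 1 : ℝ)) = {0} := by
    ext w
    simp only [mem_iInter, mem_ball, dist_zero_right, mem_singleton_iff]
    constructor
    · intro hw
      by_contra h0
      obtain ⟨n, hn⟩ := exists_nat_one_div_lt (norm_pos_iff.2 h0)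
      exact absurd (hw n) (not_lt.2 hn.le)
    · rintro rfl n; simp; positivity
  rw [he] at h
  simpa using h

/-- The Cauchy kernel integrates uniformly against `A`. -/
theorem exists_kernel_bound {D : Set ℂ} {A : ℂ → ℂ} {q : ℝ≥0∞} (hq : 2 < q)
    (hDv : volume D ≠ ⊤) (hA : MemLp A q (volume.restrict D)) :
    ∃ M : ℝ, ∀ z, IntegrableOn (fun ζ => ‖A ζ‖ / ‖ζ - z‖) D ∧
      ∫ ζ in D, ‖A ζ‖ / ‖ζ - z‖ ≤ M := by
  obtain ⟨p, s, hps, hs, hAp⟩ := exists_holderConjugate_memLp hq hDv hA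
  have : IsFiniteMeasure (volume.restrict D) := ⟨by simpa using hDv.lt_top⟩
  have hA1 : Integrable (fun ζ => ‖A ζ‖) (volume.restrict D) :=
    (hA.integrable ((by norm_num : (1 : ℝ≥0∞) ≤ 2).trans hq.le)).norm
  -- The first two terms bound the part in the unit ball about `z` (`η = δ = 1`); outside it the
  -- kernel is at most `1`, which gives the last term.
  refine ⟨1 ^ p * (∫ ζ in D, ‖A ζ‖ ^ p) + 1 ^ (-s) * (∫ w in ball (0 : ℂ) 1, ‖w‖ ^ (-s)) +
    ∫ ζ in D, ‖A ζ‖, fun z => ?_⟩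
  obtain ⟨hi, hb⟩ := lp_kernel_integral_le hps hs hAp one_pos 1 z
  have hle : ∀ ζ, ‖A ζ‖ / ‖ζ - z‖ ≤
      (ball (0 : ℂ) 1).indicator (fun w => ‖w‖⁻¹) (ζ - z) * ‖A ζ‖ + ‖A ζ‖ := fun ζ => by
    by_cases h : ζ - z ∈ ball (0 : ℂ) 1
    · rw [indicator_of_mem h, div_eq_mul_inv, mul_comm]
      linarith [norm_nonneg (A ζ)]
    · rw [indicator_of_notMem h]
      rw [mem_ball, dist_zero_right, not_lt] at h
      simpa using div_le_self (norm_nonneg (A ζ)) h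
  have hint : IntegrableOn (fun ζ => ‖A ζ‖ / ‖ζ - z‖) D := by
    refine (hi.add hA1).mono' ?_ (Eventually.of_forall fun ζ => ?_)
    · simp_rw [div_eq_mul_inv]
      exact hA.aestronglyMeasurable.norm.mul
        (by fun_prop : Measurable fun ζ : ℂ => ‖ζ - z‖⁻¹).aestronglyMeasurable
    · rw [Real.norm_of_nonneg (by positivity)]; exact hle ζ
  refine ⟨hint, (integral_mono hint (hi.add hA1) hle).trans ?_⟩
  refine (integral_add hi hA1).le.trans ?_
  gcongr

theorem norm_vekuaT_le {D : Set ℂ} {A : ℂ → ℂ} {M : ℝ}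
    {z : ℂ} (hM : ∫ ζ in D, ‖A ζ‖ / ‖ζ - z‖ ≤ M) : ‖vekuaT D A z‖ ≤ M := by
  have h0 : 0 ≤ ∫ ζ in D, ‖A ζ‖ / ‖ζ - z‖ := integral_nonneg fun ζ => by positivity
  rw [vekuaT, norm_mul]
  have h1 : ‖-(1 / (Real.pi : ℂ))‖ ≤ 1 := by
    rw [norm_neg, norm_div, norm_one, Complex.norm_real, Real.norm_of_nonneg Real.pi_pos.le,
      div_le_one Real.pi_pos]
    linarith [Real.pi_gt_three]
  have h2 : ‖∫ ζ in D, A ζ / (ζ - z)‖ ≤ ∫ ζ in D, ‖A ζ‖ / ‖ζ - z‖ := by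
    simpa only [norm_div] using norm_integral_le_integral_norm (fun ζ => A ζ / (ζ - z))
  calc _ ≤ 1 * ∫ ζ in D, ‖A ζ‖ / ‖ζ - z‖ := by gcongr
    _ ≤ M := by linarith

/-- The Cauchy kernel `1 / w` cut off to a bounded continuous function. -/
noncomputable def cutKernel (δ : ℝ) (w : ℂ) : ℂ :=
  (starRingEnd ℂ) w / ((max (‖w‖ ^ 2) (δ ^ 2) : ℝ) : ℂ)

theorem continuous_cutKernel {δ : ℝ} (hδ : 0 < δ) : Continuous (cutKernel δ) := by
  refine Complex.continuous_conj.div (by fun_prop) fun w => ?_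
  have : 0 < max (‖w‖ ^ 2) (δ ^ 2) := lt_max_of_lt_right (by positivity)
  exact_mod_cast this.ne'

theorem norm_cutKernel (δ : ℝ) (w : ℂ) : ‖cutKernel δ w‖ = ‖w‖ / max (‖w‖ ^ 2) (δ ^ 2) := by
  rw [cutKernel, norm_div, Complex.norm_real, Real.norm_of_nonneg (le_max_of_le_left (by positivity)),
    RCLike.norm_conj]

theorem norm_cutKernel_le {δ : ℝ} (hδ : 0 < δ) (w : ℂ) : ‖cutKernel δ w‖ ≤ 1 / δ := by
  have : 0 < max (‖w‖ ^ 2) (δ ^ 2) := lt_max_of_lt_right (by positivity)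
  rw [norm_cutKernel, div_le_div_iff₀ this hδ, one_mul]
  rcases le_total ‖w‖ δ with h | h
  · refine le_trans ?_ (le_max_right _ _)
    nlinarith
  · refine le_trans ?_ (le_max_left _ _)
    nlinarith [norm_nonneg w]

/-- Both kernels are nonnegative multiples of `conj w`, and the cut one is the smaller, so their
difference is no larger than `‖w‖⁻¹`; outside the ball they coincide. -/
theorem norm_inv_sub_cutKernel_le {δ : ℝ} (hδ : 0 < δ) (w : ℂ) :
    ‖w⁻¹ - cutKernel δ w‖ ≤ (ball (0 : ℂ) δ).indicator (fun w => ‖w‖⁻¹) w := by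
  by_cases h0 : w = 0
  · simp only [h0, cutKernel, inv_zero, map_zero, zero_div, sub_zero, norm_zero]
    exact indicator_nonneg (fun _ _ => by positivity) _
  have hw : 0 < ‖w‖ := norm_pos_iff.2 h0
  have hinv : w⁻¹ = (starRingEnd ℂ) w / ((‖w‖ ^ 2 : ℝ) : ℂ) := by
    rw [Complex.inv_def, Complex.normSq_eq_norm_sq]; push_cast; rw [div_eq_mul_inv]
  by_cases h : w ∈ ball (0 : ℂ) δ
  · rw [indicator_of_mem h]
    rw [mem_ball, dist_zero_right] at h
    rw [cutKernel, max_eq_right (by gcongr), hinv, ← mul_one_div,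
      ← mul_one_div (_ : ℂ) ((δ ^ 2 : ℝ) : ℂ), ← mul_sub, norm_mul, RCLike.norm_conj]
    have : ‖(1 / ((‖w‖ ^ 2 : ℝ) : ℂ) - 1 / ((δ ^ 2 : ℝ) : ℂ))‖ = 1 / ‖w‖ ^ 2 - 1 / δ ^ 2 := by
      have hh : 0 ≤ 1 / ‖w‖ ^ 2 - 1 / δ ^ 2 := by
        rw [sub_nonneg]; gcongr
      rw [← Real.norm_of_nonneg hh, ← Complex.norm_real]; push_cast; rfl
    rw [this]
    have h3 : ‖w‖ * (1 / ‖w‖ ^ 2) = ‖w‖⁻¹ := by field_simp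
    rw [mul_sub, h3]
    have : 0 ≤ ‖w‖ * (1 / δ ^ 2) := by positivity
    linarith
  · rw [indicator_of_notMem h]
    rw [mem_ball, dist_zero_right, not_lt] at h
    rw [cutKernel, max_eq_left (by gcongr), hinv]; simp

/-- A uniform limit of continuous functions, namely the integrals against the cut kernels. -/
theorem continuous_vekuaT {D : Set ℂ} {A : ℂ → ℂ} {q : ℝ≥0∞} (hq : 2 < q)
    (hDv : volume D ≠ ⊤) (hA : MemLp A q (volume.restrict D)) :
    Continuous (vekuaT D A) := by
  obtain ⟨p, s, hps, hs, hAp⟩ := exists_holderConjugate_memLp hq hDv hA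
  obtain ⟨M, hM⟩ := exists_kernel_bound hq hDv hA
  have : IsFiniteMeasure (volume.restrict D) := ⟨by simpa using hDv.lt_top⟩
  have hA1 : Integrable A (volume.restrict D) :=
    hA.integrable ((by norm_num : (1 : ℝ≥0∞) ≤ 2).trans hq.le)
  refine continuous_const.mul ?_
  have hcont : ∀ δ : ℝ, 0 < δ → Continuous fun z => ∫ ζ in D, A ζ * cutKernel δ (ζ - z) := by
    intro δ hδ
    refine continuous_of_dominated (bound := fun ζ => ‖A ζ‖ * (1 / δ)) (fun z => ?_)
      (fun z => Eventually.of_forall fun ζ => ?_) (hA1.norm.mul_const _)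
      (Eventually.of_forall fun ζ => ?_)
    · exact hA.aestronglyMeasurable.mul
        ((continuous_cutKernel hδ).comp (continuous_id.sub continuous_const)).aestronglyMeasurable
    · rw [norm_mul]; gcongr; exact norm_cutKernel_le hδ _
    · exact continuous_const.mul ((continuous_cutKernel hδ).comp
        (continuous_const.sub continuous_id))
  refine continuous_of_uniform_approx_of_continuous fun u hu => ?_
  obtain ⟨ε, hε, hεu⟩ := Metric.mem_uniformity_dist.1 hu
  set I := ∫ ζ in D, ‖A ζ‖ ^ p with hI
  have hI0 : 0 ≤ I := integral_nonneg fun ζ => by positivity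
  -- The order matters: `η` is fixed first to control the term in `A`, then the cut-off radius `1 /
  -- (n + 1)` to control the kernel term, whose factor `η ^ (-s)` may be large. Neither choice
  -- depends on `z`.
  obtain ⟨η, hη, hηI⟩ : ∃ η : ℝ, 0 < η ∧ η ^ p * I < ε / 2 := by
    have h1 : Tendsto (fun η : ℝ => η ^ p * I) (𝓝[>] 0) (𝓝 (0 ^ p * I)) :=
      ((Real.continuousAt_rpow_const 0 p (Or.inr hps.pos.le)).tendsto.mono_left
        nhdsWithin_le_nhds).mul_const I
    rw [Real.zero_rpow hps.pos.ne', zero_mul] at h1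
    obtain ⟨η, h, h'⟩ := ((h1.eventually_lt_const (by positivity : (0 : ℝ) < ε / 2)).and
      self_mem_nhdsWithin).exists
    exact ⟨η, h', h⟩
  obtain ⟨n, hn⟩ : ∃ n : ℕ, η ^ (-s) *
      ∫ w in ball (0 : ℂ) (1 / (n + 1 : ℝ)), ‖w‖ ^ (-s) < ε / 2 := by
    have h1 := (tendsto_kernel_integral hs).const_mul (η ^ (-s))
    rw [mul_zero] at h1
    exact (h1.eventually_lt_const (by positivity : (0 : ℝ) < ε / 2)).exists
  have hδ : (0 : ℝ) < 1 / (n + 1 : ℝ) := by positivity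
  refine ⟨_, hcont _ hδ, fun z => hεu ?_⟩
  obtain ⟨hi, hb⟩ := lp_kernel_integral_le hps hs hAp hη (1 / (n + 1 : ℝ)) z
  have i1 : Integrable (fun ζ => A ζ / (ζ - z)) (volume.restrict D) := by
    refine (hM z).1.mono' ?_ (Eventually.of_forall fun ζ => (norm_div _ _).le)
    simp_rw [div_eq_mul_inv]
    exact hA.aestronglyMeasurable.mul
      (by fun_prop : Measurable fun ζ : ℂ => (ζ - z)⁻¹).aestronglyMeasurable
  have i2 : Integrable (fun ζ => A ζ * cutKernel (1 / (n + 1 : ℝ)) (ζ - z))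
      (volume.restrict D) := by
    refine (hA1.norm.mul_const (1 / (1 / (n + 1 : ℝ)))).mono' ?_ (Eventually.of_forall fun ζ => ?_)
    · exact hA.aestronglyMeasurable.mul
        ((continuous_cutKernel hδ).comp (continuous_id.sub continuous_const)).aestronglyMeasurable
    · rw [norm_mul]; gcongr; exact norm_cutKernel_le hδ _
  rw [dist_eq_norm, ← integral_sub i1 i2]
  refine (norm_integral_le_of_norm_le hi (Eventually.of_forall fun ζ => ?_)).trans_lt
    (hb.trans_lt (by linarith))
  rw [div_eq_mul_inv, ← mul_sub, norm_mul, mul_comm]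
  gcongr
  exact norm_inv_sub_cutKernel_le hδ _

/-! ### Integrating factors -/

theorem integrableOn_mul_of_tsupport_subset {D : Set ℂ} {f ψ : ℂ → ℂ}
    (hf : LocallyIntegrableOn f D) (hψ : Continuous ψ) (hc : HasCompactSupport ψ)
    (hD : MeasurableSet D) (hs : tsupport ψ ⊆ D) : IntegrableOn (fun z => f z * ψ z) D := by
  have h1 : IntegrableOn (fun z => f z * ψ z) (tsupport ψ) :=
    (hf.integrableOn_compact_subset hs hc).mul_continuousOn hψ.continuousOn hc
  refine h1.of_forall_sdiff_eq_zero hD fun z hz => ?_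
  rw [image_eq_zero_of_notMem_tsupport hz.2, mul_zero]

theorem dbar_mul {f g : ℂ → ℂ} {z : ℂ} (hf : DifferentiableAt ℝ f z)
    (hg : DifferentiableAt ℝ g z) :
    dbar (fun z => f z * g z) z = f z * dbar g z + dbar f z * g z := by
  simp only [dbar, fderiv_fun_mul hf hg, add_apply, smul_apply, smul_eq_mul]
  ring

theorem dbar_exp_neg {f : ℂ → ℂ} {z : ℂ} (hf : DifferentiableAt ℝ f z) :
    dbar (fun z => Complex.exp (-f z)) z = -dbar f z * Complex.exp (-f z) := by
  have h : HasFDerivAt (fun z => Complex.exp (-f z))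
      (Complex.exp (-f z) • (-fderiv ℝ f z)) z := by
    exact hf.hasFDerivAt.neg.cexp
  simp only [dbar, h.fderiv, smul_apply, neg_apply, smul_eq_mul]
  ring

theorem IsTestFunction.smooth_mul {D : Set ℂ} {φ ψ : ℂ → ℂ} (hφ : IsTestFunction D φ)
    (hψ : ContDiff ℝ ∞ ψ) : IsTestFunction D (fun z => ψ z * φ z) :=
  ⟨hψ.mul hφ.1, hφ.2.1.mul_left, (closure_mono (Function.support_mul_subset_right _ _)).trans hφ.2.2⟩

theorem tsupport_dbar_subset (φ : ℂ → ℂ) : tsupport (dbar φ) ⊆ tsupport φ := by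
  refine closure_minimal (fun z hz => ?_) isClosed_closure
  refine tsupport_fderiv_subset ℝ (subset_closure fun h => hz ?_)
  simp [dbar, h]

theorem hasCompactSupport_dbar {φ : ℂ → ℂ} (hφ : HasCompactSupport φ) :
    HasCompactSupport (dbar φ) :=
  hφ.mono' (subset_closure.trans (tsupport_dbar_subset φ))

/-! ### Approximation of the coefficient and passage to the limit. -/

theorem exists_mollification {B : ℂ → ℂ} {n R : ℝ} (hB : AEStronglyMeasurable B)
    (hn : ∀ z, ‖B z‖ ≤ n) (hR : ∀ z, z ∉ ball (0 : ℂ) R → B z = 0) :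
    ∃ b : ℕ → ℂ → ℂ, (∀ k, ContDiff ℝ ∞ (b k)) ∧ (∀ k z, ‖b k z‖ ≤ n) ∧
      (∀ k z, z ∉ ball (0 : ℂ) (R + 1) → b k z = 0) ∧
      ∀ᵐ z, Tendsto (fun k => b k z) atTop (𝓝 (B z)) := by
  have hBl : LocallyIntegrable B := (locallyIntegrable_const n).mono hB
    (Eventually.of_forall fun z => (hn z).trans (le_abs_self n))
  -- The outer radius is always twice the inner one: a bounded ratio is what almost everywhere
  -- convergence at Lebesgue points requires.
  let φ : ℕ → ContDiffBump (0 : ℂ) := fun k =>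
    ⟨1 / (2 * (k + 1 : ℝ)), 1 / (k + 1 : ℝ), by positivity, by
      have : (0 : ℝ) < k + 1 := by positivity
      exact one_div_lt_one_div_of_lt this (by linarith)⟩
  have hφ1 : ∀ k, (φ k).rOut ≤ 1 := fun k => by
    change 1 / (k + 1 : ℝ) ≤ 1
    rw [div_le_one (by positivity)]
    linarith [(Nat.cast_nonneg k : (0 : ℝ) ≤ k)]
  refine ⟨fun k => convolution ((φ k).normed volume) B (ContinuousLinearMap.lsmul ℝ ℝ) volume,
    fun k => ?_, fun k z => ?_, fun k z hz => ?_, ?_⟩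
  · exact (φ k).hasCompactSupport_normed.contDiff_convolution_left (n := ⊤) _
      (φ k).contDiff_normed hBl
  · have h1 : ∫ t, (φ k).normed volume t * n = n := by
      rw [integral_mul_const, (φ k).integral_normed, one_mul]
    rw [← h1]
    refine norm_integral_le_of_norm_le ((φ k).integrable_normed.mul_const n)
      (Eventually.of_forall fun t => ?_)
    rw [ContinuousLinearMap.lsmul_apply, norm_smul, Real.norm_of_nonneg ((φ k).nonneg_normed t)]
    gcongr
    · exact (φ k).nonneg_normed t
    · exact hn _
  · refine integral_eq_zero_of_ae (Eventually.of_forall fun t => ?_)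
    simp only [ContinuousLinearMap.lsmul_apply, Pi.zero_apply]
    by_cases ht : t ∈ ball (0 : ℂ) (φ k).rOut
    · rw [hR, smul_zero]
      rw [mem_ball, dist_zero_right] at ht hz ⊢
      have := norm_sub_norm_le z t
      linarith [hφ1 k]
    · rw [← (φ k).support_normed_eq (μ := volume), Function.notMem_support] at ht
      rw [ht, zero_smul]
  · refine ContDiffBump.ae_convolution_tendsto_right_of_locallyIntegrable (K := 2) ?_
      (Eventually.of_forall fun k => ?_) hBl
    · exact tendsto_one_div_add_atTop_nhds_zero_nat
    · change 1 / (k + 1 : ℝ) ≤ 2 * (1 / (2 * (k + 1 : ℝ)))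
      apply le_of_eq; field_simp

theorem tendsto_vekuaT {D : Set ℂ} {A : ℂ → ℂ} {b : ℕ → ℂ → ℂ} {G : ℂ → ℝ} {z : ℂ}
    (hb : ∀ k, AEStronglyMeasurable (b k) (volume.restrict D))
    (hG : IntegrableOn (fun ζ => G ζ / ‖ζ - z‖) D)
    (hbG : ∀ k, ∀ᵐ ζ ∂volume.restrict D, ‖b k ζ‖ ≤ G ζ)
    (hlim : ∀ᵐ ζ ∂volume.restrict D, Tendsto (fun k => b k ζ) atTop (𝓝 (A ζ))) :
    Tendsto (fun k => vekuaT D (b k) z) atTop (𝓝 (vekuaT D A z)) := by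
  refine Tendsto.const_mul _ ?_
  refine tendsto_integral_of_dominated_convergence _ (fun k => ?_) hG (fun k => ?_) ?_
  · simp_rw [div_eq_mul_inv]
    exact (hb k).mul (by fun_prop : Measurable fun ζ : ℂ => (ζ - z)⁻¹).aestronglyMeasurable
  · filter_upwards [hbG k] with ζ h
    rw [norm_div]; gcongr
  · filter_upwards [hlim] with ζ h using h.div_const _

theorem vekuaT_univ_of_eq_zero {D : Set ℂ} {A : ℂ → ℂ} (h : ∀ z, z ∉ D → A z = 0) :
    vekuaT univ A = vekuaT D A := by
  ext z
  rw [vekuaT, vekuaT, setIntegral_univ, setIntegral_eq_integral_of_forall_compl_eq_zero]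
  intro ζ hζ
  rw [h ζ hζ, zero_div]

theorem norm_cexp_neg_le {a : ℂ} {M : ℝ} (h : ‖a‖ ≤ M) : ‖Complex.exp (-a)‖ ≤ Real.exp M := by
  rw [Complex.norm_exp]
  refine Real.exp_le_exp.2 ((Complex.re_le_norm _).trans ?_)
  rwa [norm_neg]

/-- Limits in the weak equation multiplied by uniformly bounded factors. -/
theorem tendsto_weak_integral {D : Set ℂ} {f : ℂ → ℂ} {M : ℝ} {φ : ℂ → ℂ} (hD : MeasurableSet D)
    (hf : LocallyIntegrableOn f D) (hφc : Continuous φ) (hφ : HasCompactSupport φ)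
    (hs : tsupport φ ⊆ D)
    {e : ℕ → ℂ → ℂ} {e' : ℂ → ℂ} (he : ∀ k, AEStronglyMeasurable (e k) (volume.restrict D))
    (hM : ∀ k, ∀ᵐ z ∂volume.restrict D, ‖e k z‖ ≤ M)
    (hlim : ∀ᵐ z ∂volume.restrict D, Tendsto (fun k => e k z) atTop (𝓝 (e' z))) :
    Tendsto (fun k => ∫ z in D, e k z * (f z * φ z)) atTop (𝓝 (∫ z in D, e' z * (f z * φ z))) := by
  have hi := integrableOn_mul_of_tsupport_subset hf hφc hφ hD hs
  refine tendsto_integral_of_dominated_convergence (fun z => M * ‖f z * φ z‖) (fun k => ?_)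
    (hi.norm.const_mul M) (fun k => ?_) ?_
  · exact (he k).mul hi.aestronglyMeasurable
  · filter_upwards [hM k] with z h
    rw [norm_mul]; gcongr
  · filter_upwards [hlim] with z h using h.mul_const _

/-- `e^{-T_ℂ B}` as integrating factor for a test function `B`. -/
theorem weak_integratingFactor_smooth {D : Set ℂ} {f F B : ℂ → ℂ} (hD : MeasurableSet D)
    (h : HasWeakDbar D f F)
    (hB : ContDiff ℝ ∞ B) (hBc : HasCompactSupport B) {φ : ℂ → ℂ} (hφ : IsTestFunction D φ) :
    (∫ z in D, Complex.exp (-vekuaT univ B z) * (f z * dbar φ z)) -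
      ∫ z in D, (Complex.exp (-vekuaT univ B z) * B z) * (f z * φ z) =
      -∫ z in D, Complex.exp (-vekuaT univ B z) * (F z * φ z) := by
  have hT := contDiff_vekuaT hB hBc
  have hTd : Differentiable ℝ (vekuaT univ B) := hT.differentiable (by simp)
  have hE : ContDiff ℝ ∞ fun z => Complex.exp (-vekuaT univ B z) := hT.neg.cexp
  -- `e^{-T B} φ` is again a test function, and its `∂/∂z̄` is `e^{-T B} (∂φ/∂z̄ - B φ)` since `T`
  -- is a right inverse of `∂/∂z̄`.
  have key := h.2.2 _ (hφ.smooth_mul hE)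
  have i1 := integrableOn_mul_of_tsupport_subset h.1 (hE.continuous.mul (continuous_dbar hφ.1))
    ((hasCompactSupport_dbar hφ.2.1).mul_left) hD ((closure_mono
      (Function.support_mul_subset_right _ _)).trans ((tsupport_dbar_subset φ).trans hφ.2.2))
  have hφ2 := hφ.smooth_mul (hE.mul hB)
  have i2 := integrableOn_mul_of_tsupport_subset h.1 hφ2.1.continuous hφ2.2.1 hD hφ2.2.2
  have e1 : ∀ z, f z * dbar (fun z => Complex.exp (-vekuaT univ B z) * φ z) z =
      f z * (Complex.exp (-vekuaT univ B z) * dbar φ z) -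
      f z * (Complex.exp (-vekuaT univ B z) * B z * φ z) := fun z => by
    rw [dbar_mul (hE.differentiable (by simp) z) (hφ.1.differentiable (by simp) z),
      dbar_exp_neg (hTd z), dbar_vekuaT hB hBc]
    ring
  simp_rw [e1] at key
  have key2 := (integral_sub i1 i2).symm.trans key
  simp only [Pi.mul_apply] at key2
  convert key2 using 2
  · congr 1; ext z; ring
  · congr 1; ext z; ring
  · congr 1; ext z; ring

/-- Mollify `B`. The mollified functions share one bound and one supporting ball, so their
transforms are uniformly bounded and dominated convergence applies to all three integrals. -/
theorem weak_integratingFactor_bounded {D : Set ℂ} {f F B : ℂ → ℂ} (hD : MeasurableSet D)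
    (h : HasWeakDbar D f F) {n R : ℝ} (hB : AEStronglyMeasurable B)
    (hn : ∀ z, ‖B z‖ ≤ n) (hR : ∀ z, z ∉ ball (0 : ℂ) R → B z = 0)
    {φ : ℂ → ℂ} (hφ : IsTestFunction D φ) :
    (∫ z in D, Complex.exp (-vekuaT univ B z) * (f z * dbar φ z)) -
      ∫ z in D, (Complex.exp (-vekuaT univ B z) * B z) * (f z * φ z) =
      -∫ z in D, Complex.exp (-vekuaT univ B z) * (F z * φ z) := by
  obtain ⟨b, hb, hbn, hbR, hlim⟩ := exists_mollification hB hn hR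
  have hbc : ∀ k, HasCompactSupport (b k) := fun k =>
    HasCompactSupport.intro (isCompact_closedBall 0 (R + 1)) fun z hz =>
      hbR k z fun hz' => hz (ball_subset_closedBall hz')
  obtain ⟨M, hM⟩ := exists_kernel_bound (D := ball (0 : ℂ) (R + 1)) (A := fun _ => (n : ℂ))
    (q := ⊤) (by simp) measure_ball_lt_top.ne (memLp_top_const _)
  have hn0 : 0 ≤ n := (norm_nonneg _).trans (hn 0)
  have hnn : ‖(n : ℂ)‖ = n := by rw [Complex.norm_real, Real.norm_of_nonneg hn0]
  have hTb : ∀ k, vekuaT univ (b k) = vekuaT (ball 0 (R + 1)) (b k) := fun k =>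
    vekuaT_univ_of_eq_zero (hbR k)
  have hTB : vekuaT univ B = vekuaT (ball 0 (R + 1)) B :=
    vekuaT_univ_of_eq_zero fun z hz => hR z fun hz' => hz (ball_subset_ball (by linarith) hz')
  have hTM : ∀ k z, ‖vekuaT univ (b k) z‖ ≤ M := fun k z => by
    rw [hTb]
    refine norm_vekuaT_le (le_trans ?_ (hM z).2)
    refine integral_mono_of_nonneg (Eventually.of_forall fun ζ => by positivity) (hM z).1
      (Eventually.of_forall fun ζ => ?_)
    simp only [hnn]
    gcongr
    exact hbn k ζ
  have hE : ∀ z, Tendsto (fun k => Complex.exp (-vekuaT univ (b k) z)) atTop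
      (𝓝 (Complex.exp (-vekuaT univ B z))) := fun z => by
    refine (Complex.continuous_exp.tendsto _).comp (Tendsto.neg ?_)
    simp_rw [hTb, hTB]
    exact tendsto_vekuaT (fun k => (hb k).continuous.aestronglyMeasurable) (hM z).1
      (fun k => Eventually.of_forall fun ζ => by rw [hnn]; exact hbn k ζ) (ae_restrict_of_ae hlim)
  have hEm : ∀ k, Continuous (fun z => Complex.exp (-vekuaT univ (b k) z)) := fun k =>
    Complex.continuous_exp.comp (contDiff_vekuaT (hb k) (hbc k)).continuous.neg
  have t1 := tendsto_weak_integral hD h.1 (continuous_dbar hφ.1) (hasCompactSupport_dbar hφ.2.1)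
    ((tsupport_dbar_subset φ).trans hφ.2.2) (fun k => (hEm k).aestronglyMeasurable)
    (fun k => Eventually.of_forall fun z => norm_cexp_neg_le (hTM k z)) (Eventually.of_forall hE)
  have t2 := tendsto_weak_integral hD h.1 hφ.1.continuous hφ.2.1 hφ.2.2 (M := Real.exp M * n)
    (e := fun k z => Complex.exp (-vekuaT univ (b k) z) * b k z)
    (e' := fun z => Complex.exp (-vekuaT univ B z) * B z)
    (fun k => ((hEm k).mul (hb k).continuous).aestronglyMeasurable)
    (fun k => Eventually.of_forall fun z => by
      rw [norm_mul]
      exact mul_le_mul (norm_cexp_neg_le (hTM k z)) (hbn k z) (norm_nonneg _) (Real.exp_pos _).le)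
    (by filter_upwards [ae_restrict_of_ae hlim] with z hz using (hE z).mul hz)
  have t3 := tendsto_weak_integral hD h.2.1 hφ.1.continuous hφ.2.1 hφ.2.2
    (fun k => (hEm k).aestronglyMeasurable)
    (fun k => Eventually.of_forall fun z => norm_cexp_neg_le (hTM k z)) (Eventually.of_forall hE)
  refine tendsto_nhds_unique (t1.sub t2) (t3.neg.congr fun k => ?_)
  exact (weak_integratingFactor_smooth hD h (hb k) (hbc k) hφ).symm

/-- `e^{-T_D A}` is an integrating factor for `∂/∂z̄ - A`, where `A ∈ L^q(D)`, `q > 2`. -/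
theorem HasWeakDbar.integratingFactor {D : Set ℂ} {A f g : ℂ → ℂ} {q : ℝ≥0∞} (hq : 2 < q)
    (hDo : IsOpen D) (hDb : Bornology.IsBounded D) (hA : MemLp A q (volume.restrict D))
    (hg : LocallyIntegrableOn g D) (h : HasWeakDbar D f (fun z => A z * f z + g z)) :
    HasWeakDbar D (fun z => Complex.exp (-vekuaT D A z) * f z)
      (fun z => Complex.exp (-vekuaT D A z) * g z) := by
  have hD := hDo.measurableSet
  have hDv : volume D ≠ ⊤ := hDb.measure_lt_top.ne
  -- The product `A f` is not assumed locally integrable; it is so as the difference of `A f + g`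
  -- and `g`.
  have hAf : LocallyIntegrableOn (fun z => A z * f z) D := by
    have e : (fun z => A z * f z + g z) - g = fun z => A z * f z := by ext z; simp
    exact e ▸ h.2.1.sub hg
  have hEc : Continuous fun z => Complex.exp (-vekuaT D A z) :=
    Complex.continuous_exp.comp (continuous_vekuaT hq hDv hA).neg
  refine ⟨h.1.continuousOn_mul hEc.continuousOn hDo.isLocallyClosed,
    hg.continuousOn_mul hEc.continuousOn hDo.isLocallyClosed, fun φ hφ => ?_⟩
  obtain ⟨R, hR⟩ := hDb.subset_ball 0
  obtain ⟨M, hM⟩ := exists_kernel_bound hq hDv hA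
  set A0 := hA.aestronglyMeasurable.mk A
  have hA0 : A =ᵐ[volume.restrict D] A0 := hA.aestronglyMeasurable.ae_eq_mk
  have hA0m : StronglyMeasurable A0 := hA.aestronglyMeasurable.stronglyMeasurable_mk
  -- Truncation at height `n`, made on a measurable representative so that `S n` is measurable.
  let S : ℕ → Set ℂ := fun n => D ∩ {z | ‖A0 z‖ ≤ n}
  have hS : ∀ n, MeasurableSet (S n) := fun n =>
    hD.inter (measurableSet_le hA0m.norm.measurable measurable_const)
  let b : ℕ → ℂ → ℂ := fun n => (S n).indicator A0
  have hbm : ∀ n, StronglyMeasurable (b n) := fun n => hA0m.indicator (hS n)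
  have hbn : ∀ n z, ‖b n z‖ ≤ n := fun n z => by
    by_cases hz : z ∈ S n
    · simpa [b, hz] using hz.2
    · simp [b, hz]
  have hb0 : ∀ n z, z ∉ D → b n z = 0 := fun n z hz =>
    indicator_of_notMem (fun h' => hz h'.1) _
  have hbA : ∀ n, ∀ᵐ z ∂volume.restrict D, ‖b n z‖ ≤ ‖A z‖ := fun n => by
    filter_upwards [hA0] with z hz
    rw [hz]; exact norm_indicator_le_norm_self _ _
  have hSlim : ∀ z ∈ D, ∀ᶠ n in atTop, z ∈ S n := fun z hz => by
    filter_upwards [eventually_ge_atTop ⌈‖A0 z‖⌉₊] with n hn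
    exact ⟨hz, Nat.ceil_le.1 hn⟩
  have hlim : ∀ᵐ z ∂volume.restrict D, Tendsto (fun n => b n z) atTop (𝓝 (A z)) := by
    filter_upwards [hA0, ae_restrict_mem hD] with z hz hzD
    refine tendsto_const_nhds.congr' ?_
    filter_upwards [hSlim z hzD] with n hn
    simp only [b, indicator_of_mem hn, hz]
  have hTb : ∀ k, vekuaT univ (b k) = vekuaT D (b k) := fun k => vekuaT_univ_of_eq_zero (hb0 k)
  have hTM : ∀ k z, ‖vekuaT univ (b k) z‖ ≤ M := fun k z => by
    rw [hTb]
    refine norm_vekuaT_le (le_trans ?_ (hM z).2)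
    refine integral_mono_of_nonneg (Eventually.of_forall fun ζ => by positivity) (hM z).1 ?_
    filter_upwards [hbA k] with ζ hζ
    gcongr
  have hE : ∀ z, Tendsto (fun k => Complex.exp (-vekuaT univ (b k) z)) atTop
      (𝓝 (Complex.exp (-vekuaT D A z))) := fun z => by
    refine (Complex.continuous_exp.tendsto _).comp (Tendsto.neg ?_)
    simp_rw [hTb]
    exact tendsto_vekuaT (fun k => (hbm k).aestronglyMeasurable) (hM z).1 hbA hlim
  have hEm : ∀ k, Continuous (fun z => Complex.exp (-vekuaT univ (b k) z)) := fun k => by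
    rw [hTb]
    exact Complex.continuous_exp.comp (continuous_vekuaT (q := ⊤) (by simp) hDv
      (memLp_top_of_bound (hbm k).aestronglyMeasurable k
        (Eventually.of_forall (hbn k)))).neg
  have t1 := tendsto_weak_integral hD h.1 (continuous_dbar hφ.1) (hasCompactSupport_dbar hφ.2.1)
    ((tsupport_dbar_subset φ).trans hφ.2.2) (fun k => (hEm k).aestronglyMeasurable)
    (fun k => Eventually.of_forall fun z => norm_cexp_neg_le (hTM k z)) (Eventually.of_forall hE)
  -- Here `b k * f` is written as `A f` times the indicator of `S k`, so that the dominating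
  -- function comes from `A f`; the bounds on `b k` grow with `k` and would not serve.
  have t2 := tendsto_weak_integral hD hAf hφ.1.continuous hφ.2.1 hφ.2.2 (M := Real.exp M)
    (e := fun k z => Complex.exp (-vekuaT univ (b k) z) * (S k).indicator 1 z)
    (e' := fun z => Complex.exp (-vekuaT D A z))
    (fun k => (hEm k).aestronglyMeasurable.mul
      (stronglyMeasurable_one.indicator (hS k)).aestronglyMeasurable)
    (fun k => Eventually.of_forall fun z => by
      rw [norm_mul]
      refine (mul_le_of_le_one_right (norm_nonneg _) ?_).trans (norm_cexp_neg_le (hTM k z))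
      by_cases hz : z ∈ S k <;> simp [hz])
    (by
      filter_upwards [ae_restrict_mem hD] with z hz
      refine (hE z).congr' ?_
      filter_upwards [hSlim z hz] with n hn
      simp [hn])
  have t3 := tendsto_weak_integral hD h.2.1 hφ.1.continuous hφ.2.1 hφ.2.2
    (fun k => (hEm k).aestronglyMeasurable)
    (fun k => Eventually.of_forall fun z => norm_cexp_neg_le (hTM k z)) (Eventually.of_forall hE)
  have key := tendsto_nhds_unique (t1.sub t2) (t3.neg.congr fun k => by
    rw [← weak_integratingFactor_bounded hD h (hbm k).aestronglyMeasurable (hbn k)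
      (fun z hz => hb0 k z fun hz' => hz (hR hz')) hφ]
    congr 1
    refine integral_congr_ae ?_
    filter_upwards [hA0] with z hz
    by_cases hzS : z ∈ S k
    · simp only [b, indicator_of_mem hzS, Pi.one_apply, hz]; ring
    · simp [b, hzS])
  have hint : ∀ {u : ℂ → ℂ}, LocallyIntegrableOn u D →
      Integrable (fun z => Complex.exp (-vekuaT D A z) * (u z * φ z)) (volume.restrict D) := by
    intro u hu
    have := integrableOn_mul_of_tsupport_subset hu (hEc.mul hφ.1.continuous) hφ.2.1.mul_left hD
      ((closure_mono (Function.support_mul_subset_right _ _)).trans hφ.2.2)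
    refine this.congr (Eventually.of_forall fun z => ?_)
    simp only [Pi.mul_apply]; ring
  have e3 : ∫ z in D, Complex.exp (-vekuaT D A z) * ((A z * f z + g z) * φ z) =
      (∫ z in D, Complex.exp (-vekuaT D A z) * (A z * f z * φ z)) +
        ∫ z in D, Complex.exp (-vekuaT D A z) * (g z * φ z) := by
    rw [← integral_add (hint hAf) (hint hg)]
    congr 1; ext z; ring
  rw [e3] at key
  simp only [mul_assoc] at key ⊢
  linear_combination key

/-! ### Weyl's lemma and bianalytic functions -/

/-- Where the density is nonzero the kernel stays at distance at least `r` from its singularity, so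
one may differentiate under the integral. -/
theorem differentiableOn_vekuaT {D : Set ℂ} {k : ℂ → ℂ} (hk : IntegrableOn k D) {z₀ : ℂ} {r : ℝ}
    (hr : 0 < r) (h0 : ∀ ζ ∈ ball z₀ (2 * r), k ζ = 0) :
    DifferentiableOn ℂ (vekuaT D k) (ball z₀ r) := by
  intro z hz
  refine DifferentiableAt.differentiableWithinAt ?_
  have hfar : ∀ x ∈ ball z₀ r, ∀ ζ, k ζ ≠ 0 → r ≤ ‖ζ - x‖ := fun x hx ζ hζ => by
    have h1 : 2 * r ≤ dist ζ z₀ := not_lt.1 fun h => hζ (h0 ζ h)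
    have h2 := dist_triangle ζ x z₀
    rw [mem_ball] at hx
    rw [← dist_eq_norm]; linarith
  have hm : ∀ x, AEStronglyMeasurable (fun ζ => k ζ / (ζ - x)) (volume.restrict D) := fun x => by
    simp_rw [div_eq_mul_inv]
    exact hk.aestronglyMeasurable.mul
      (by fun_prop : Measurable fun ζ : ℂ => (ζ - x)⁻¹).aestronglyMeasurable
  have h := hasDerivAt_integral_of_dominated_loc_of_deriv_le (μ := volume.restrict D)
    (F := fun x ζ => k ζ / (ζ - x)) (F' := fun x ζ => k ζ / (ζ - x) ^ 2)
    (bound := fun ζ => ‖k ζ‖ / r ^ 2) (x₀ := z) (s := ball z₀ r) (isOpen_ball.mem_nhds hz)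
    (Eventually.of_forall hm) ?_ ?_ ?_ (hk.norm.div_const _) ?_
  · exact h.2.differentiableAt.const_mul _
  · refine (hk.norm.div_const r).mono' (hm z) (Eventually.of_forall fun ζ => ?_)
    by_cases hζ : k ζ = 0
    · simp [hζ]
    · rw [norm_div]; gcongr; exact hfar z hz ζ hζ
  · simp_rw [div_eq_mul_inv]
    exact hk.aestronglyMeasurable.mul
      (by fun_prop : Measurable fun ζ : ℂ => ((ζ - z) ^ 2)⁻¹).aestronglyMeasurable
  · refine Eventually.of_forall fun ζ x hx => ?_
    by_cases hζ : k ζ = 0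
    · simp [hζ]
    · rw [norm_div, norm_pow]; gcongr; exact hfar x hx ζ hζ
  · refine Eventually.of_forall fun ζ x hx => ?_
    by_cases hζ : k ζ = 0
    · simpa [hζ] using hasDerivAt_const x (0 : ℂ)
    · have hne : ζ - x ≠ 0 := norm_pos_iff.1 (hr.trans_le (hfar x hx ζ hζ))
      have h2 := ((hasDerivAt_const x (k ζ))).div ((hasDerivAt_id x).const_sub ζ) hne
      refine h2.congr_deriv ?_
      simp

/-- For a cut-off `X` equal to `1` near `z₀`, formally `∂(X h)/∂z̄ = h ∂X/∂z̄ = k`, whence `h = T_D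
k` near `z₀`; this is holomorphic because `k` vanishes there. The identity is proved by duality. -/
theorem weyl_local {D : Set ℂ} (hD : IsOpen D) {h : ℂ → ℂ} (hh : HasWeakDbar D h (fun _ => 0))
    {z₀ : ℂ} (hz₀ : z₀ ∈ D) :
    ∃ r > 0, ball z₀ r ⊆ D ∧ ∃ F : ℂ → ℂ, DifferentiableOn ℂ F (ball z₀ r) ∧
      ∀ᵐ z, z ∈ ball z₀ r → h z = F z := by
  obtain ⟨ρ, hρ, hρD⟩ := Metric.nhds_basis_closedBall.mem_iff.1 (hD.mem_nhds hz₀)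
  set r := ρ / 3 with hr
  have hr0 : 0 < r := by positivity
  have hrρ : ρ = 3 * r := by rw [hr]; ring
  let χ : ContDiffBump z₀ := ⟨2 * r, 3 * r, by positivity, by linarith⟩
  let X : ℂ → ℂ := fun z => (χ z : ℂ)
  have hX : ContDiff ℝ ∞ X := Complex.ofRealCLM.contDiff.comp χ.contDiff
  have hXs : tsupport X ⊆ closedBall z₀ ρ := by
    rw [hrρ]
    refine closure_minimal (fun z hz => ?_) isClosed_closedBall
    have : z ∈ Function.support χ := fun h' => hz (by simp [X, h'])
    rw [χ.support_eq] at this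
    exact ball_subset_closedBall this
  have hXc : HasCompactSupport X :=
    HasCompactSupport.intro (isCompact_closedBall z₀ ρ) fun z hz =>
      image_eq_zero_of_notMem_tsupport fun h' => hz (hXs h')
  have hX1 : ∀ z ∈ ball z₀ (2 * r), X z = 1 := fun z hz => by
    simp [X, χ.one_of_mem_closedBall (ball_subset_closedBall hz)]
  have hXd : ∀ z ∈ ball z₀ (2 * r), dbar X z = 0 := fun z hz => by
    have he : X =ᶠ[𝓝 z] fun _ => 1 := by
      filter_upwards [isOpen_ball.mem_nhds hz] with w hw using hX1 w hw
    simp [dbar, he.fderiv_eq]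
  set k : ℂ → ℂ := fun ζ => h ζ * dbar X ζ with hk
  have hki : IntegrableOn k D := integrableOn_mul_of_tsupport_subset hh.1 (continuous_dbar hX)
    (hasCompactSupport_dbar hXc) hD.measurableSet
    ((tsupport_dbar_subset X).trans (hXs.trans hρD))
  have hk0 : ∀ ζ ∈ ball z₀ (2 * r), k ζ = 0 := fun ζ hζ => by simp [hk, hXd ζ hζ]
  have hF := differentiableOn_vekuaT hki hr0 hk0
  have hsub : ball z₀ r ⊆ D :=
    (ball_subset_closedBall.trans (closedBall_subset_closedBall (by linarith))).trans hρD
  refine ⟨r, hr0, hsub, vekuaT D k, hF, ?_⟩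
  have hloc : LocallyIntegrableOn (fun z => h z - vekuaT D k z) (ball z₀ r) :=
    (hh.1.mono_set hsub).sub (hF.continuousOn.locallyIntegrableOn measurableSet_ball)
  have key := isOpen_ball.ae_eq_zero_of_integral_contDiff_smul_eq_zero hloc ?_
  · filter_upwards [key] with z hz hzr using sub_eq_zero.1 (hz hzr)
  intro g hg hgc hgs
  let ψ : ℂ → ℂ := fun z => (g z : ℂ)
  have hψ : ContDiff ℝ ∞ ψ := Complex.ofRealCLM.contDiff.comp hg
  have hψsupp : tsupport ψ ⊆ tsupport g :=
    closure_mono fun z hz h' => hz (by simp [ψ, h'])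
  have hψc : HasCompactSupport ψ := hgc.mono' (subset_closure.trans hψsupp)
  have hψs : tsupport ψ ⊆ ball z₀ r := hψsupp.trans hgs
  have hψ0 : ∀ z, z ∉ ball z₀ r → ψ z = 0 := fun z hz =>
    image_eq_zero_of_notMem_tsupport fun h' => hz (hψs h')
  have hT := contDiff_vekuaT hψ hψc
  have htest : IsTestFunction D X := ⟨hX, hXc, hXs.trans hρD⟩
  -- Testing with `X · T ψ` yields `ψ` itself near `z₀`, as `∂(T ψ)/∂z̄ = ψ`; the remaining term
  -- contains `k`, and Fubini moves `T` from `ψ` onto `k`.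
  have h0 := hh.2.2 _ (htest.smooth_mul hT)
  have hXψ : ∀ z, X z * ψ z = ψ z := fun z => by
    by_cases hz : z ∈ ball z₀ r
    · rw [hX1 z (ball_subset_ball (by linarith) hz), one_mul]
    · rw [hψ0 z hz, mul_zero]
  have e1 : ∀ z, h z * dbar (fun z => vekuaT univ ψ z * X z) z =
      k z * vekuaT univ ψ z + h z * ψ z := fun z => by
    rw [dbar_mul (hT.differentiable (by simp) z) (hX.differentiable (by simp) z),
      dbar_vekuaT hψ hψc, mul_comm (ψ z), hXψ]
    ring
  have i1 : IntegrableOn (fun z => k z * vekuaT univ ψ z) D := by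
    have := integrableOn_mul_of_tsupport_subset hh.1 (hT.continuous.mul (continuous_dbar hX))
      ((hasCompactSupport_dbar hXc).mul_left) hD.measurableSet ((closure_mono
        (Function.support_mul_subset_right _ _)).trans ((tsupport_dbar_subset X).trans htest.2.2))
    refine this.congr_fun (fun z _ => ?_) hD.measurableSet
    simp only [Pi.mul_apply, hk]; ring
  have i2 : IntegrableOn (fun z => h z * ψ z) D :=
    integrableOn_mul_of_tsupport_subset hh.1 hψ.continuous hψc hD.measurableSet (hψs.trans hsub)
  simp_rw [e1] at h0
  rw [integral_add i1 i2] at h0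
  simp only [zero_mul, integral_zero, neg_zero] at h0
  -- No singularity occurs: `k` vanishes on the ball of radius `2 r` and `ψ` outside that of radius
  -- `r`.
  have hfub : Integrable (fun p : ℂ × ℂ => k p.1 * (ψ p.2 / (p.2 - p.1)))
      ((volume.restrict D).prod volume) := by
    have hψi : Integrable ψ := hψ.continuous.integrable_of_hasCompactSupport hψc
    have hb := (hki.norm.mul_prod (hψi.norm.div_const r))
    refine hb.mono' ?_ (Eventually.of_forall fun p => ?_)
    · have m1 : AEStronglyMeasurable (fun p : ℂ × ℂ => k p.1) ((volume.restrict D).prod volume) :=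
        hki.aestronglyMeasurable.comp_fst
      have m2 : Measurable fun p : ℂ × ℂ => ψ p.2 / (p.2 - p.1) :=
        (hψ.continuous.measurable.comp measurable_snd).div (measurable_snd.sub measurable_fst)
      exact m1.mul m2.aestronglyMeasurable
    · rw [norm_mul, norm_div]
      by_cases hp1 : p.1 ∈ ball z₀ (2 * r)
      · rw [hk0 _ hp1]; simp
      by_cases hp2 : p.2 ∈ ball z₀ r
      · gcongr
        have h2 := dist_triangle p.1 p.2 z₀
        rw [mem_ball] at hp1 hp2
        rw [← dist_eq_norm, dist_comm]; linarith
      · rw [hψ0 _ hp2]; simp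
  have e2 : ∫ z in D, k z * vekuaT univ ψ z = - ∫ z, ψ z * vekuaT D k z := by
    have l1 : ∀ z, k z * vekuaT univ ψ z =
        -(1 / (Real.pi : ℂ)) * ∫ ζ, k z * (ψ ζ / (ζ - z)) := fun z => by
      rw [vekuaT, setIntegral_univ, integral_const_mul]; ring
    have l2 : ∀ z, ψ z * vekuaT D k z =
        (1 / (Real.pi : ℂ)) * ∫ ζ in D, k ζ * (ψ z / (z - ζ)) := fun z => by
      have : ∀ ζ, k ζ * (ψ z / (z - ζ)) = -ψ z * (k ζ / (ζ - z)) := fun ζ => by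
        rw [← neg_sub ζ z, div_neg]; ring
      simp_rw [this]
      rw [integral_const_mul, vekuaT]; ring
    simp_rw [l1, l2]
    rw [integral_const_mul, integral_const_mul, integral_integral_swap hfub]
    ring
  have e3 : ∫ z in D, h z * ψ z = ∫ z, h z * ψ z :=
    setIntegral_eq_integral_of_forall_compl_eq_zero fun z hz => by
      rw [hψ0 z fun h' => hz (hsub h'), mul_zero]
  have i3 : Integrable fun z => h z * ψ z :=
    (integrableOn_iff_integrable_of_support_subset fun z hz => by
      by_contra h'
      exact hz (by simp [hψ0 z fun h'' => h' (hsub h'')])).1 i2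
  have i4 : Integrable fun z => ψ z * vekuaT D k z := by
    have := integrableOn_mul_of_tsupport_subset
      (hF.continuousOn.locallyIntegrableOn measurableSet_ball (μ := volume)) hψ.continuous hψc
      measurableSet_ball hψs
    refine (integrableOn_iff_integrable_of_support_subset (s := ball z₀ r) fun z hz => ?_).1
      (this.congr_fun (fun z _ => mul_comm _ _) measurableSet_ball)
    by_contra h'
    exact hz (by simp [hψ0 z h'])
  rw [e2, e3] at h0
  have e4 : ∀ z, g z • (h z - vekuaT D k z) = h z * ψ z - ψ z * vekuaT D k z := fun z => by
    rw [Complex.real_smul]; ring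
  simp_rw [e4]
  rw [integral_sub i3 i4]
  linear_combination h0

/-- **Weyl's lemma** for the Cauchy–Riemann operator. -/
theorem HasWeakDbar.ae_eq_holomorphic {D : Set ℂ} (hD : IsOpen D) {h : ℂ → ℂ}
    (hh : HasWeakDbar D h (fun _ => 0)) :
    ∃ F : ℂ → ℂ, DifferentiableOn ℂ F D ∧ ∀ᵐ z ∂volume.restrict D, h z = F z := by
  choose! r hr hrD G hG hGae using fun z (hz : z ∈ D) => weyl_local hD hh hz
  -- Local representatives agree almost everywhere on overlaps, hence everywhere by continuity, so
  -- the diagonal `z ↦ G z z` glues them.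
  have heq : ∀ z ∈ D, ∀ w ∈ ball z (r z), G w w = G z w := by
    intro z hz w hw
    have hwD := hrD z hz hw
    have hopen : IsOpen (ball w (r w) ∩ ball z (r z)) := isOpen_ball.inter isOpen_ball
    have := Measure.eqOn_open_of_ae_eq (μ := (volume : Measure ℂ)) (f := G w) (g := G z)
      (U := ball w (r w) ∩ ball z (r z)) (by
        rw [EventuallyEq, ae_restrict_iff' hopen.measurableSet]
        filter_upwards [hGae z hz, hGae w hwD] with x h1 h2 hx
        rw [← h1 hx.2, h2 hx.1]) hopen ((hG w hwD).continuousOn.mono inter_subset_left)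
      ((hG z hz).continuousOn.mono inter_subset_right)
    exact this ⟨mem_ball_self (hr w hwD), hw⟩
  refine ⟨fun z => G z z, fun z hz => ?_, ?_⟩
  · have h1 := (hG z hz).differentiableAt (isOpen_ball.mem_nhds (mem_ball_self (hr z hz)))
    refine (h1.congr_of_eventuallyEq ?_).differentiableWithinAt
    filter_upwards [isOpen_ball.mem_nhds (mem_ball_self (hr z hz))] with w hw using heq z hz w hw
  · rw [ae_restrict_iff' hD.measurableSet, ae_iff]
    refine measure_null_of_locally_null _ fun z hz => ?_
    rw [mem_ofPred_eq, Classical.not_imp] at hz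
    refine ⟨_, inter_mem_nhdsWithin _ (isOpen_ball.mem_nhds (mem_ball_self (hr z hz.1))), ?_⟩
    have := ae_iff.1 (hGae z hz.1)
    refine measure_mono_null (fun w hw => ?_) this
    simp only [mem_inter_iff, mem_ofPred_eq, Classical.not_imp] at hw ⊢
    exact ⟨hw.2, fun h' => hw.1.2 (by rw [heq z hz.1 w hw.2]; exact h')⟩

theorem dbar_conj (z : ℂ) : dbar (starRingEnd ℂ) z = 1 := by
  have h : HasFDerivAt (starRingEnd ℂ) (Complex.conjCLE : ℂ →L[ℝ] ℂ) z :=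
    Complex.conjCLE.hasFDerivAt
  rw [dbar, h.fderiv]
  simp
  norm_num

theorem contDiff_conj : ContDiff ℝ ∞ (starRingEnd ℂ) := Complex.conjCLE.contDiff

/-- Continuous weak solutions of `∂²V/∂z̄² = 0` are bianalytic. -/
theorem bianalytic_of_weak {D : Set ℂ} (hD : IsOpen D) {V h : ℂ → ℂ} (hV : ContinuousOn V D)
    (hVh : HasWeakDbar D V h) (hh : HasWeakDbar D h (fun _ => 0)) :
    ∃ f g : ℂ → ℂ, DifferentiableOn ℂ f D ∧ DifferentiableOn ℂ g D ∧
      ∀ z ∈ D, V z = (starRingEnd ℂ) z * f z + g z := by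
  have hcl := LocallyIntegrableOn.continuousOn_mul hh.1 Complex.continuous_conj.continuousOn
    hD.isLocallyClosed
  -- As `h` is weakly holomorphic, `∂(z̄ h)/∂z̄ = h`, so subtracting `z̄ h` from `V` leaves a weakly
  -- holomorphic function.
  have hw : HasWeakDbar D (fun z => V z - (starRingEnd ℂ) z * h z) (fun _ => 0) := by
    refine ⟨hVh.1.sub hcl, locallyIntegrableOn_zero, fun φ hφ => ?_⟩
    have h1 := hh.2.2 _ (hφ.smooth_mul contDiff_conj)
    have e1 : ∀ z, h z * dbar (fun z => (starRingEnd ℂ) z * φ z) z =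
        (starRingEnd ℂ) z * h z * dbar φ z + h z * φ z := fun z => by
      rw [dbar_mul (contDiff_conj.differentiable (by simp) z) (hφ.1.differentiable (by simp) z),
        dbar_conj]
      ring
    have hs := (tsupport_dbar_subset φ).trans hφ.2.2
    have hdc := hasCompactSupport_dbar hφ.2.1
    have i1 := integrableOn_mul_of_tsupport_subset hcl (continuous_dbar hφ.1) hdc
      hD.measurableSet hs
    have i2 := integrableOn_mul_of_tsupport_subset hh.1 hφ.1.continuous hφ.2.1
      hD.measurableSet hφ.2.2
    have i3 := integrableOn_mul_of_tsupport_subset hVh.1 (continuous_dbar hφ.1) hdc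
      hD.measurableSet hs
    simp_rw [e1] at h1
    rw [integral_add i1 i2] at h1
    simp only [sub_mul]
    rw [integral_sub i3 i1, hVh.2.2 φ hφ]
    simp only [zero_mul, integral_zero, neg_zero] at h1 ⊢
    linear_combination -h1
  obtain ⟨f, hf, hfae⟩ := hh.ae_eq_holomorphic hD
  obtain ⟨g, hg, hgae⟩ := hw.ae_eq_holomorphic hD
  refine ⟨f, g, hf, hg, ?_⟩
  refine Measure.eqOn_open_of_ae_eq (μ := (volume : Measure ℂ)) ?_ hD hV
    ((Complex.continuous_conj.continuousOn.mul hf.continuousOn).add hg.continuousOn)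
  filter_upwards [hfae, hgae] with z h1 h2
  rw [← h1, ← h2]; ring

/-! ### Uniqueness in an ellipse -/

section

/-- The interior estimate for the `∂/∂z̄`-derivative of a bianalytic function. -/
theorem bianalytic_interior_estimate {f g V : ℂ → ℂ} {D : Set ℂ} {z : ℂ} {ρ ε : ℝ} (hρ : 0 < ρ)
    (hρD : closedBall z ρ ⊆ D) (hf : DifferentiableOn ℂ f D)
    (hg : DifferentiableOn ℂ g D) (hV : ∀ w ∈ D, V w = conj w * f w + g w)
    (hε : ∀ w ∈ sphere z ρ, ‖V w‖ ≤ ε) : ρ * ‖f z‖ ≤ ε := by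
  have hfc : DiffContOnCl ℂ f (ball z ρ) :=
    (hf.mono (by rw [closure_ball z hρ.ne']; exact hρD)).diffContOnCl
  have hgc : DiffContOnCl ℂ g (ball z ρ) :=
    (hg.mono (by rw [closure_ball z hρ.ne']; exact hρD)).diffContOnCl
  have hsD : sphere z ρ ⊆ D := sphere_subset_closedBall.trans hρD
  have i0 : (∮ w in C(z, ρ), (conj z * f w + g w)) = 0 := by
    have hh : DiffContOnCl ℂ (fun w => conj z * f w + g w) (ball z ρ) :=
      (hfc.const_smul (conj z)).add hgc
    exact Complex.circleIntegral_eq_zero_of_differentiable_on_off_countable hρ.le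
      countable_empty (by simpa [closure_ball z hρ.ne'] using hh.continuousOn)
      fun w hw => hh.differentiableAt isOpen_ball hw.1
  have i1 : (∮ w in C(z, ρ), (w - z)⁻¹ • f w) = (2 * Real.pi * Complex.I : ℂ) • f z :=
    hfc.circleIntegral_sub_inv_smul (mem_ball_self hρ)
  have hne : ∀ w ∈ sphere z ρ, w - z ≠ 0 := fun w hw h => by
    rw [mem_sphere, dist_eq_norm, h, norm_zero] at hw
    exact hρ.ne hw
  -- On the circle `w̄ = z̄ + ρ² / (w - z)`. The contour integral of `V` thus isolates `f z` by
  -- Cauchy's formula, and the holomorphic part drops out.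
  have hVeq : ∀ w ∈ sphere z ρ, V w = (conj z * f w + g w) + ρ ^ 2 * ((w - z)⁻¹ • f w) := by
    intro w hw
    have h1 : (w - z) * conj (w - z) = (ρ : ℂ) ^ 2 := by
      rw [Complex.mul_conj, Complex.normSq_eq_norm_sq, ← dist_eq_norm, mem_sphere.1 hw]
      push_cast; rfl
    have h2 : conj w = conj z + ρ ^ 2 * (w - z)⁻¹ := by
      rw [← h1, mul_comm (w - z), mul_assoc, mul_inv_cancel₀ (hne w hw), map_sub]; ring
    rw [hV w (hsD hw), h2, smul_eq_mul]; ring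
  have c1 : CircleIntegrable (fun w => conj z * f w + g w) z ρ :=
    ContinuousOn.circleIntegrable hρ.le ((continuousOn_const.mul (hf.continuousOn.mono hsD)).add
      (hg.continuousOn.mono hsD))
  have c2 : CircleIntegrable (fun w => (ρ : ℂ) ^ 2 * ((w - z)⁻¹ • f w)) z ρ :=
    ContinuousOn.circleIntegrable hρ.le (continuousOn_const.mul
      (((continuousOn_id.sub continuousOn_const).inv₀ hne).smul (hf.continuousOn.mono hsD)))
  have i2 : (∮ w in C(z, ρ), V w) = ρ ^ 2 * ((2 * Real.pi * Complex.I : ℂ) * f z) := by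
    rw [circleIntegral.integral_congr hρ.le hVeq, circleIntegral.integral_add c1 c2, i0,
      circleIntegral.integral_const_mul, i1, zero_add, smul_eq_mul]
  have hb := circleIntegral.norm_integral_le_of_norm_le_const hρ.le hε
  rw [i2] at hb
  simp only [norm_mul, norm_pow, Complex.norm_real, Complex.norm_I, Real.norm_eq_abs,
    abs_of_pos hρ, abs_of_pos Real.pi_pos, RCLike.norm_ofNat, mul_one] at hb
  have : (2 * Real.pi * ρ) * (ρ * ‖f z‖) ≤ (2 * Real.pi * ρ) * ε := by linarith
  exact le_of_mul_le_mul_left this (by positivity)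

/-- A holomorphic function on an annulus that vanishes on the outer circle is zero. -/
theorem eq_zero_of_annulus {r₀ : ℝ} (hr₀ : 0 < r₀) {F : ℂ → ℂ}
    (hF : DifferentiableOn ℂ F {ζ | r₀ < ‖ζ‖ ∧ ‖ζ‖ < 1})
    (hFc : ContinuousOn F {ζ | r₀ ≤ ‖ζ‖ ∧ ‖ζ‖ ≤ 1}) (h1 : ∀ ζ, ‖ζ‖ = 1 → F ζ = 0)
    {ζ₀ : ℂ} (hζ₀ : r₀ < ‖ζ₀‖) (hζ₁ : ‖ζ₀‖ < 1) : F ζ₀ = 0 := by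
  set U : Set ℂ := {ζ | r₀ < ‖ζ‖ ∧ ‖ζ‖ < 1} with hU
  have hUo : IsOpen U := (isOpen_lt continuous_const continuous_norm).inter
    (isOpen_lt continuous_norm continuous_const)
  have hKc : IsClosed {ζ : ℂ | r₀ ≤ ‖ζ‖ ∧ ‖ζ‖ ≤ 1} :=
    (isClosed_le continuous_const continuous_norm).inter
      (isClosed_le continuous_norm continuous_const)
  have hcl : closure U ⊆ {ζ : ℂ | r₀ ≤ ‖ζ‖ ∧ ‖ζ‖ ≤ 1} :=
    closure_minimal (fun ζ h => ⟨h.1.le, h.2.le⟩) hKc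
  have hfr : ∀ ζ ∈ frontier U, ‖ζ‖ = r₀ ∨ ‖ζ‖ = 1 := fun ζ hζ => by
    rw [hUo.frontier_eq] at hζ
    have h2 := hcl hζ.1
    by_contra! hc
    exact hζ.2 ⟨lt_of_le_of_ne h2.1 hc.1.symm, lt_of_le_of_ne h2.2 hc.2⟩
  have hK : IsCompact {ζ : ℂ | r₀ ≤ ‖ζ‖ ∧ ‖ζ‖ ≤ 1} :=
    (isCompact_closedBall (0 : ℂ) 1).of_isClosed_subset hKc fun ζ h => by simpa using h.2
  obtain ⟨M, hM⟩ := hK.exists_bound_of_continuousOn hFc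
  have hM0 : 0 ≤ M := (norm_nonneg _).trans (hM ζ₀ ⟨hζ₀.le, hζ₁.le⟩)
  have hUb : Bornology.IsBounded U := hK.isBounded.subset (subset_closure.trans hcl)
  -- The maximum principle for `ζ ^ k * F ζ`: the outer circle contributes nothing, and on the inner
  -- one the factor is `r₀ ^ k`, which loses against `‖ζ₀‖ ^ k`.
  have key : ∀ k : ℕ, ‖F ζ₀‖ ≤ M * (r₀ / ‖ζ₀‖) ^ k := by
    intro k
    have hd : DiffContOnCl ℂ (fun ζ => ζ ^ k * F ζ) U :=
      ⟨((differentiable_pow k).differentiableOn).mul hF,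
        (continuous_pow k).continuousOn.mul (hFc.mono hcl)⟩
    have := Complex.norm_le_of_forall_mem_frontier_norm_le hUb hd (C := r₀ ^ k * M)
      (fun ζ hζ => by
        rcases hfr ζ hζ with h | h
        · rw [norm_mul, norm_pow, h]; gcongr; exact hM ζ (hcl (frontier_subset_closure hζ))
        · simp only [h1 ζ h, mul_zero, norm_zero]; positivity)
      (subset_closure (⟨hζ₀, hζ₁⟩ : ζ₀ ∈ U))
    rw [norm_mul, norm_pow] at this
    have hpos : 0 < ‖ζ₀‖ ^ k := pow_pos (hr₀.trans hζ₀) k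
    rw [div_pow, mul_div_assoc', le_div_iff₀ hpos]
    linarith
  have hlim : Tendsto (fun k : ℕ => M * (r₀ / ‖ζ₀‖) ^ k) atTop (𝓝 (M * 0)) :=
    (tendsto_pow_atTop_nhds_zero_of_lt_one (by positivity)
      ((div_lt_one (hr₀.trans hζ₀)).2 hζ₀)).const_mul M
  have := ge_of_tendsto' hlim key
  rw [mul_zero] at this
  exact norm_le_zero_iff.1 this

/-! ### The Joukowski covering of the ellipse and its Schwarz function. -/

/-- The ellipse `{c + p η + s η̄ : |η| < 1}` written by means of the inverse of
`η ↦ p η + s η̄`. -/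
def ellipse (c p s : ℂ) : Set ℂ := {z | ‖conj p * (z - c) - s * conj (z - c)‖ < ‖p‖ ^ 2 - ‖s‖ ^ 2}

/-- The twofold covering of an ellipse by an annulus. -/
noncomputable def joukowski (c p s ζ : ℂ) : ℂ := c + p * ζ + s / ζ

variable {c p s : ℂ}

theorem isOpen_ellipse : IsOpen (ellipse c p s) :=
  isOpen_lt (by fun_prop) continuous_const

theorem joukowski_coord {ζ : ℂ} (hζ : ζ ≠ 0) :
    conj p * (joukowski c p s ζ - c) - s * conj (joukowski c p s ζ - c) =
      ζ * ((‖p‖ ^ 2 - ‖s‖ ^ 2 / ‖ζ‖ ^ 2 : ℝ) : ℂ) +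
        conj p * s * (((1 - ‖ζ‖ ^ 2) / ‖ζ‖ ^ 2 : ℝ) : ℂ) * conj ζ := by
  have hc : conj ζ ≠ 0 := by simpa using hζ
  have e : ∀ w : ℂ, ((‖w‖ ^ 2 : ℝ) : ℂ) = w * conj w := fun w => by
    rw [Complex.mul_conj, Complex.normSq_eq_norm_sq]
  rw [Complex.ofReal_sub, Complex.ofReal_div, Complex.ofReal_div, Complex.ofReal_sub, e, e, e,
    joukowski]
  simp only [map_sub, map_add, map_mul, map_div₀, Complex.ofReal_one]
  field_simp
  ring

/-- The subtracted term is a margin proportional to `1 - ‖ζ‖` on `‖ζ‖ ≥ r₀ > ‖s‖ / ‖p‖`;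
`bianalytic_eq_zero` needs it to fit balls of comparable radius into the ellipse. -/
theorem joukowski_coord_norm_le {ζ : ℂ} (hp : ‖s‖ < ‖p‖ * ‖ζ‖) (h1 : ‖ζ‖ ≤ 1) (h0 : 0 < ‖ζ‖) :
    ‖conj p * (joukowski c p s ζ - c) - s * conj (joukowski c p s ζ - c)‖ ≤
      ‖p‖ ^ 2 - ‖s‖ ^ 2 - (1 - ‖ζ‖) * ((‖p‖ - ‖s‖) * (‖p‖ * ‖ζ‖ - ‖s‖)) := by
  rw [joukowski_coord (norm_pos_iff.1 h0)]
  refine (norm_add_le _ _).trans ?_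
  simp only [norm_mul, Complex.norm_real, Real.norm_eq_abs, RCLike.norm_conj]
  set r := ‖ζ‖
  set P := ‖p‖
  set S := ‖s‖
  have hS : 0 ≤ S := norm_nonneg s
  have hP : S < P := by nlinarith [norm_nonneg p]
  have a1 : 0 ≤ P ^ 2 - S ^ 2 / r ^ 2 := by
    rw [sub_nonneg, div_le_iff₀ (by positivity)]
    nlinarith
  have a2 : 0 ≤ (1 - r ^ 2) / r ^ 2 := div_nonneg (by nlinarith) (by positivity)
  rw [abs_of_nonneg a1, abs_of_nonneg a2]
  have e : P ^ 2 - S ^ 2 - (r * (P ^ 2 - S ^ 2 / r ^ 2) + P * S * ((1 - r ^ 2) / r ^ 2) * r) =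
      (1 - r) / r * ((P - S) * (P * r - S)) := by
    field_simp; ring
  have h3 : (1 - r) * ((P - S) * (P * r - S)) ≤ (1 - r) / r * ((P - S) * (P * r - S)) := by
    refine mul_le_mul_of_nonneg_right ?_ (mul_nonneg (by linarith) (by linarith))
    rw [le_div_iff₀ h0]; nlinarith
  linarith

theorem joukowski_coord_le_norm {ζ : ℂ} (hp : ‖s‖ < ‖p‖) (h1 : 1 ≤ ‖ζ‖) :
    ‖p‖ ^ 2 - ‖s‖ ^ 2 ≤
      ‖conj p * (joukowski c p s ζ - c) - s * conj (joukowski c p s ζ - c)‖ := by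
  have h0 : 0 < ‖ζ‖ := by linarith
  rw [joukowski_coord (norm_pos_iff.1 h0)]
  refine le_trans ?_ (norm_sub_le_norm_add _ _)
  simp only [norm_mul, Complex.norm_real, Real.norm_eq_abs, RCLike.norm_conj]
  set r := ‖ζ‖
  set P := ‖p‖
  set S := ‖s‖
  have hS : 0 ≤ S := norm_nonneg s
  have a1 : 0 ≤ P ^ 2 - S ^ 2 / r ^ 2 := by
    rw [sub_nonneg, div_le_iff₀ (by positivity)]
    have h := pow_le_pow_left₀ hS (show S ≤ P * r by nlinarith) 2
    rwa [mul_pow] at h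
  have a2 : (1 - r ^ 2) / r ^ 2 ≤ 0 := div_nonpos_of_nonpos_of_nonneg (by nlinarith) (by positivity)
  rw [abs_of_nonneg a1, abs_of_nonpos a2]
  have e : r * (P ^ 2 - S ^ 2 / r ^ 2) - P * S * (-((1 - r ^ 2) / r ^ 2)) * r - (P ^ 2 - S ^ 2) =
      (r - 1) / r * ((P - S) * (P * r - S)) := by
    field_simp; ring
  have h3 : 0 ≤ (r - 1) / r * ((P - S) * (P * r - S)) :=
    mul_nonneg (div_nonneg (by linarith) h0.le) (mul_nonneg (by linarith) (by nlinarith))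
  linarith

theorem joukowski_mem_ellipse {ζ : ℂ} (hp : ‖s‖ < ‖p‖ * ‖ζ‖) (h1 : ‖ζ‖ < 1) (h0 : 0 < ‖ζ‖) :
    joukowski c p s ζ ∈ ellipse c p s := by
  refine (joukowski_coord_norm_le hp h1.le h0).trans_lt ?_
  have : ‖s‖ < ‖p‖ := by nlinarith [norm_nonneg p]
  have : 0 < (1 - ‖ζ‖) * ((‖p‖ - ‖s‖) * (‖p‖ * ‖ζ‖ - ‖s‖)) :=
    mul_pos (by linarith) (mul_pos (by linarith) (by linarith))
  linarith

theorem joukowski_involution (hs : s ≠ 0) (hp : p ≠ 0) {ζ : ℂ} (hζ : ζ ≠ 0) :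
    joukowski c p s (s / (p * ζ)) = joukowski c p s ζ := by
  unfold joukowski; field_simp; ring

/-- The preimages of `z` are the roots of `p ζ² - (z - c) ζ + s`, with product `s / p`. Points with
`‖ζ‖ ≥ 1` land outside, so both roots have norm below `1`, and therefore each has norm above `‖s‖ /
‖p‖`. -/
theorem exists_joukowski_eq (hs : s ≠ 0) (hp : ‖s‖ < ‖p‖) {z : ℂ} (hz : z ∈ ellipse c p s) :
    ∃ ζ, ‖s‖ < ‖p‖ * ‖ζ‖ ∧ ‖ζ‖ < 1 ∧ joukowski c p s ζ = z := by
  have hp0 : p ≠ 0 := norm_pos_iff.1 ((norm_nonneg s).trans_lt hp)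
  obtain ⟨ζ, hζ⟩ := exists_quadratic_eq_zero (a := p) (b := -(z - c)) (c := s) hp0
    (IsAlgClosed.exists_eq_mul_self _)
  have hζ0 : ζ ≠ 0 := by rintro rfl; simp at hζ; exact hs hζ
  have hJ : joukowski c p s ζ = z := by
    unfold joukowski; field_simp; linear_combination hζ
  have hlt : ∀ w, joukowski c p s w = z → ‖w‖ < 1 := fun w hw => by
    by_contra! h
    have := joukowski_coord_le_norm (c := c) hp h
    rw [hw] at this
    exact absurd hz (not_lt.2 this)
  refine ⟨ζ, ?_, hlt ζ hJ, hJ⟩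
  have := hlt _ ((joukowski_involution hs hp0 hζ0).trans hJ)
  rwa [norm_div, norm_mul, div_lt_one (by positivity)] at this

theorem closedBall_subset_ellipse {z : ℂ} {ρ : ℝ}
    (h : ‖conj p * (z - c) - s * conj (z - c)‖ + (‖p‖ + ‖s‖) * ρ < ‖p‖ ^ 2 - ‖s‖ ^ 2) :
    closedBall z ρ ⊆ ellipse c p s := by
  intro w hw
  rw [mem_closedBall, dist_eq_norm] at hw
  have e : conj p * (w - c) - s * conj (w - c) =
      (conj p * (z - c) - s * conj (z - c)) + (conj p * (w - z) - s * conj (w - z)) := by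
    simp only [map_sub]; ring
  change ‖_‖ < _
  rw [e]
  refine ((norm_add_le _ _).trans (add_le_add_right (norm_sub_le _ _) _)).trans_lt ?_
  simp only [norm_mul, RCLike.norm_conj]
  have : (‖p‖ + ‖s‖) * ‖w - z‖ ≤ (‖p‖ + ‖s‖) * ρ := by gcongr
  linarith

/-- The Schwarz function of the ellipse in the coordinate of the annulus. -/
noncomputable def schwarzFn (c p s ζ : ℂ) : ℂ := conj c + conj p / ζ + conj s * ζ

theorem norm_conj_sub_schwarzFn_le {ζ : ℂ} (h1 : ‖ζ‖ ≤ 1) (h0 : 0 < ‖ζ‖) :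
    ‖conj (joukowski c p s ζ) - schwarzFn c p s ζ‖ ≤
      2 * (‖p‖ + ‖s‖) / ‖ζ‖ * (1 - ‖ζ‖) := by
  have hζ : ζ ≠ 0 := norm_pos_iff.1 h0
  have hc : conj ζ ≠ 0 := by simpa using hζ
  have e : conj (joukowski c p s ζ) - schwarzFn c p s ζ =
      conj p * ((ζ * conj ζ - 1) / ζ) - conj s * ((ζ * conj ζ - 1) / conj ζ) := by
    simp only [joukowski, schwarzFn, map_add, map_mul, map_div₀]
    field_simp; ring
  have e2 : ‖ζ * conj ζ - 1‖ = 1 - ‖ζ‖ ^ 2 := by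
    rw [Complex.mul_conj, Complex.normSq_eq_norm_sq, ← Complex.ofReal_one, ← Complex.ofReal_sub,
      Complex.norm_real, Real.norm_eq_abs, abs_of_nonpos (by nlinarith)]
    ring
  rw [e]
  refine (norm_sub_le _ _).trans ?_
  simp only [norm_mul, norm_div, RCLike.norm_conj, e2]
  rw [← add_mul, div_mul_eq_mul_div, mul_div_assoc']
  refine div_le_div_of_nonneg_right ?_ h0.le
  have : 1 - ‖ζ‖ ^ 2 ≤ 2 * (1 - ‖ζ‖) := by nlinarith
  have h3 : 0 ≤ ‖p‖ + ‖s‖ := by positivity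
  nlinarith

/-- Uniqueness for `∂²V/∂z̄² = 0` in an ellipse that is not a disc. -/
theorem bianalytic_eq_zero (hs : s ≠ 0) (hp : ‖s‖ < ‖p‖) {f g V : ℂ → ℂ}
    (hf : DifferentiableOn ℂ f (ellipse c p s)) (hg : DifferentiableOn ℂ g (ellipse c p s))
    (hV : Continuous V) (hV0 : ∀ z, z ∉ ellipse c p s → V z = 0)
    (hVfg : ∀ z ∈ ellipse c p s, V z = conj z * f z + g z) : V = 0 := by
  have hp0 : 0 < ‖p‖ := (norm_nonneg s).trans_lt hp
  have hs0 : 0 < ‖s‖ := norm_pos_iff.2 hs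
  have hpne : p ≠ 0 := norm_pos_iff.1 hp0
  let F : ℂ → ℂ := fun ζ => schwarzFn c p s ζ * f (joukowski c p s ζ) + g (joukowski c p s ζ)
  have hF0 : ∀ ζ : ℂ, ‖s‖ < ‖p‖ * ‖ζ‖ → ‖ζ‖ < 1 → F ζ = 0 := by
    intro ζ₀ hζ₀ hζ₁
    obtain ⟨r₀, hr₀, hr₁⟩ := exists_between ((div_lt_iff₀' hp0).2 hζ₀)
    rw [div_lt_iff₀' hp0] at hr₀
    have hr0 : 0 < r₀ := pos_of_mul_pos_right (hs0.trans hr₀) hp0.le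
    have hann : ∀ ζ : ℂ, r₀ ≤ ‖ζ‖ → ‖s‖ < ‖p‖ * ‖ζ‖ := fun ζ h =>
      hr₀.trans_le (by gcongr)
    have hJd : ∀ ζ : ℂ, ζ ≠ 0 → DifferentiableAt ℂ (joukowski c p s) ζ := fun ζ h => by
      unfold joukowski; fun_prop (disch := assumption)
    have hSd : ∀ ζ : ℂ, ζ ≠ 0 → DifferentiableAt ℂ (schwarzFn c p s) ζ := fun ζ h => by
      unfold schwarzFn; fun_prop (disch := assumption)
    have hFd : ∀ ζ : ℂ, r₀ ≤ ‖ζ‖ → ‖ζ‖ < 1 → DifferentiableAt ℂ F ζ := fun ζ h h' => by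
      have hζ : ζ ≠ 0 := norm_pos_iff.1 (hr0.trans_le h)
      have hmem := isOpen_ellipse.mem_nhds
        (joukowski_mem_ellipse (c := c) (hann ζ h) h' (hr0.trans_le h))
      exact ((hSd ζ hζ).mul ((hf.differentiableAt hmem).comp ζ (hJd ζ hζ))).add
        ((hg.differentiableAt hmem).comp ζ (hJd ζ hζ))
    -- Half the margin of `joukowski_coord_norm_le` at `r₀`, divided by the Lipschitz constant `‖p‖
    -- + ‖s‖` of the coordinate: the ball of radius `κ (1 - ‖ζ‖)` about the image of `ζ` stays
    -- inside.
    set κ := (‖p‖ - ‖s‖) * (‖p‖ * r₀ - ‖s‖) / (2 * (‖p‖ + ‖s‖)) with hκ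
    have hκ0 : 0 < κ := div_pos (mul_pos (by linarith) (by linarith)) (by linarith)
    set C := 2 * (‖p‖ + ‖s‖) / r₀ with hC
    have hC0 : 0 < C := by positivity
    -- the estimate of `F` by the values of `V` nearby
    have hest : ∀ (ζ : ℂ) (ε : ℝ), r₀ ≤ ‖ζ‖ → ‖ζ‖ < 1 →
        (∀ w ∈ closedBall (joukowski c p s ζ) (κ * (1 - ‖ζ‖)), ‖V w‖ ≤ ε) →
        ‖F ζ‖ ≤ (1 + C / κ) * ε := by
      intro ζ ε h h' hε
      have hζ0 : 0 < ‖ζ‖ := hr0.trans_le h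
      have hρ : 0 < κ * (1 - ‖ζ‖) := mul_pos hκ0 (by linarith)
      have hmem := joukowski_mem_ellipse (c := c) (hann ζ h) h' hζ0
      have hsub : closedBall (joukowski c p s ζ) (κ * (1 - ‖ζ‖)) ⊆ ellipse c p s := by
        apply closedBall_subset_ellipse
        have h1 := joukowski_coord_norm_le (c := c) (hann ζ h) h'.le hζ0
        have h2 : (‖p‖ + ‖s‖) * (κ * (1 - ‖ζ‖)) =
            (1 - ‖ζ‖) * ((‖p‖ - ‖s‖) * (‖p‖ * r₀ - ‖s‖)) / 2 := by
          rw [hκ]; field_simp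
        have h3 : (1 - ‖ζ‖) * ((‖p‖ - ‖s‖) * (‖p‖ * r₀ - ‖s‖)) ≤
            (1 - ‖ζ‖) * ((‖p‖ - ‖s‖) * (‖p‖ * ‖ζ‖ - ‖s‖)) := by
          have : 0 ≤ 1 - ‖ζ‖ := by linarith
          have : 0 ≤ ‖p‖ - ‖s‖ := by linarith
          gcongr
        have h4 : 0 < (1 - ‖ζ‖) * ((‖p‖ - ‖s‖) * (‖p‖ * r₀ - ‖s‖)) :=
          mul_pos (by linarith) (mul_pos (by linarith) (by linarith))
        rw [h2]; linarith
      have hfe := bianalytic_interior_estimate hρ hsub hf hg hVfg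
        fun w hw => hε w (sphere_subset_closedBall hw)
      -- The factor `z̄ - S(ζ)` is `O(1 - ‖ζ‖)` and the interior estimate bounds `(1 - ‖ζ‖) |f|` by
      -- `ε / κ`, so a possible blow-up of `f` at the boundary is compensated.
      have hFe : F ζ = V (joukowski c p s ζ) -
          (conj (joukowski c p s ζ) - schwarzFn c p s ζ) * f (joukowski c p s ζ) := by
        rw [hVfg _ hmem]; ring
      have hVe := hε _ (mem_closedBall_self hρ.le)
      have hfe' : (1 - ‖ζ‖) * ‖f (joukowski c p s ζ)‖ ≤ ε / κ := by
        rw [le_div_iff₀ hκ0]; linarith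
      have hsch : ‖conj (joukowski c p s ζ) - schwarzFn c p s ζ‖ ≤ C * (1 - ‖ζ‖) := by
        refine (norm_conj_sub_schwarzFn_le h'.le hζ0).trans ?_
        have : 0 ≤ 1 - ‖ζ‖ := by linarith
        rw [hC]; gcongr
      rw [hFe]
      refine (norm_sub_le _ _).trans ?_
      rw [norm_mul]
      calc _ ≤ ε + C * (1 - ‖ζ‖) * ‖f (joukowski c p s ζ)‖ := by gcongr
        _ = ε + C * ((1 - ‖ζ‖) * ‖f (joukowski c p s ζ)‖) := by ring
        _ ≤ ε + C * (ε / κ) := by gcongr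
        _ = _ := by ring
    classical
    -- `f` and `g` carry no information on the boundary; setting `G = 0` on `‖ζ‖ = 1` makes
    -- continuity there the statement that `F` tends to `0`.
    let G : ℂ → ℂ := fun ζ => if ‖ζ‖ < 1 then F ζ else 0
    have hGF : ∀ ζ, ‖ζ‖ < 1 → G ζ = F ζ := fun ζ h => if_pos h
    have hGe : ∀ ζ, ‖ζ‖ < 1 → G =ᶠ[𝓝 ζ] F := fun ζ h => by
      filter_upwards [(isOpen_lt continuous_norm continuous_const).mem_nhds h] with w hw
        using hGF w hw
    have hG : G ζ₀ = 0 := by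
      refine eq_zero_of_annulus (F := G) hr0 (fun ζ hζ => ?_) (fun ζ hζ => ?_) (fun ζ h => if_neg (by simp [h]))
        hr₁ hζ₁
      · exact ((hFd ζ hζ.1.le hζ.2).congr_of_eventuallyEq (hGe ζ hζ.2)).differentiableWithinAt
      · rcases hζ.2.lt_or_eq with h | h
        · exact ((hFd ζ hζ.1 h).continuousAt.congr (hGe ζ h).symm).continuousWithinAt
        have hG1 : G ζ = 0 := if_neg (by simp [h])
        have hζne : ζ ≠ 0 := norm_pos_iff.1 (by rw [h]; exact one_pos)
        have hV1 : V (joukowski c p s ζ) = 0 :=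
          hV0 _ (not_lt.2 (joukowski_coord_le_norm hp h.ge))
        rw [ContinuousWithinAt, hG1, Metric.tendsto_nhds]
        intro ε hε
        have hε' : 0 < ε / (1 + C / κ) / 2 := by positivity
        obtain ⟨δ, hδ, hVδ⟩ := Metric.continuousAt_iff.1
          (hV.continuousAt (x := joukowski c p s ζ)) _ hε'
        have n1 : ∀ᶠ w in 𝓝 ζ, dist (joukowski c p s w) (joukowski c p s ζ) < δ / 2 :=
          (hJd ζ hζne).continuousAt (Metric.ball_mem_nhds _ (by positivity))
        have n2 : ∀ᶠ w : ℂ in 𝓝 ζ, κ * (1 - ‖w‖) < δ / 2 := by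
          have : Tendsto (fun w : ℂ => κ * (1 - ‖w‖)) (𝓝 ζ) (𝓝 (κ * (1 - ‖ζ‖))) :=
            (by fun_prop : Continuous fun w : ℂ => κ * (1 - ‖w‖)).tendsto ζ
          rw [h, sub_self, mul_zero] at this
          exact this.eventually_lt_const (by positivity)
        filter_upwards [nhdsWithin_le_nhds n1, nhdsWithin_le_nhds n2, self_mem_nhdsWithin]
          with w hw1 hw2 hw3
        rw [dist_zero_right]
        rcases hw3.2.lt_or_eq with h' | h'
        · rw [hGF w h']
          refine (hest w (ε / (1 + C / κ) / 2) hw3.1 h' fun x hx => ?_).trans_lt ?_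
          · have hd := hVδ (x := x) (by
              have := dist_triangle x (joukowski c p s w) (joukowski c p s ζ)
              rw [mem_closedBall] at hx
              linarith)
            rw [hV1, dist_zero_right] at hd
            exact hd.le
          · have : (1 + C / κ) * (ε / (1 + C / κ) / 2) = ε / 2 := by field_simp
            rw [this]; linarith
        · simp only [G, h', lt_irrefl, if_false, norm_zero]; exact hε
    rwa [hGF ζ₀ hζ₁] at hG
  have hgood : ∀ z, (z - c) ^ 2 ≠ 4 * p * s → V z = 0 := by
    intro z hz
    by_cases hzD : z ∈ ellipse c p s
    swap
    · exact hV0 z hzD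
    obtain ⟨ζ, hζs, hζ1, rfl⟩ := exists_joukowski_eq hs hp hzD
    have hζ0 : 0 < ‖ζ‖ := pos_of_mul_pos_right (hs0.trans hζs) hp0.le
    have hζne : ζ ≠ 0 := norm_pos_iff.1 hζ0
    have h1 := hF0 ζ hζs hζ1
    -- The second point over the same `z`. Subtracting the two equations eliminates `g`.
    have h2 := hF0 (s / (p * ζ))
      (by
        rw [norm_div, norm_mul]; field_simp; exact hζ1)
      (by rwa [norm_div, norm_mul, div_lt_one (by positivity)])
    simp only [F, joukowski_involution hs hpne hζne] at h1 h2
    have h3 : (schwarzFn c p s ζ - schwarzFn c p s (s / (p * ζ))) * f (joukowski c p s ζ) = 0 := by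
      linear_combination h1 - h2
    have h4 : (schwarzFn c p s ζ - schwarzFn c p s (s / (p * ζ))) * (p * ζ * s) =
        (p * conj p - s * conj s) * (s - p * ζ ^ 2) := by
      unfold schwarzFn; field_simp; ring
    have h5 : p * conj p - s * conj s ≠ 0 := by
      rw [Complex.mul_conj, Complex.mul_conj, Complex.normSq_eq_norm_sq, Complex.normSq_eq_norm_sq]
      have : ‖p‖ ^ 2 - ‖s‖ ^ 2 ≠ 0 := by nlinarith
      exact_mod_cast this
    have h6 : s - p * ζ ^ 2 ≠ 0 := fun h => hz (by
      have hs' : s = p * ζ ^ 2 := by linear_combination h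
      rw [hs', joukowski]; field_simp; ring)
    have h7 : schwarzFn c p s ζ - schwarzFn c p s (s / (p * ζ)) ≠ 0 := fun h => by
      rw [h, zero_mul] at h4
      exact mul_ne_zero h5 h6 h4.symm
    have hf0 := (mul_eq_zero.1 h3).resolve_left h7
    rw [hf0, mul_zero, zero_add] at h1
    rw [hVfg _ hzD, hf0, h1]; ring
  -- The excluded points are the foci, the branch values of the covering; continuity of `V` takes
  -- care of them.
  have hfin : {z : ℂ | (z - c) ^ 2 = 4 * p * s}.Finite := by
    obtain ⟨a, ha⟩ := IsAlgClosed.exists_eq_mul_self (4 * p * s)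
    refine (Set.toFinite {c + a, c - a}).subset fun z hz => ?_
    have h : (z - c - a) * (z - c + a) = 0 := by
      have : (z - c) ^ 2 = a * a := hz.trans ha
      linear_combination this
    rcases mul_eq_zero.1 h with h | h
    · left; linear_combination h
    · right; rw [mem_singleton_iff]; linear_combination h
  refine Continuous.ext_on (hfin.countable.dense_compl ℝ) hV continuous_zero fun z hz => ?_
  exact hgood z hz

end

section

/-! ### Smooth functions as weak solutions -/

theorem integral_dbar_eq_zero {D : Set ℂ} {φ : ℂ → ℂ} (hφ : IsTestFunction D φ) :
    ∫ z in D, dbar φ z = 0 := by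
  have h0 : ∀ z, z ∉ D → dbar φ z = 0 := fun z hz =>
    image_eq_zero_of_notMem_tsupport fun h => hz (hφ.2.2 (tsupport_dbar_subset φ h))
  rw [setIntegral_eq_integral_of_forall_compl_eq_zero h0]
  have hi : ∀ v, Integrable fun z => fderiv ℝ φ z v := fun v =>
    ((hφ.1.continuous_fderiv (by simp)).clm_apply continuous_const).integrable_of_hasCompactSupport
      (hφ.2.1.fderiv_apply ℝ v)
  have hz : ∀ v, ∫ z, fderiv ℝ φ z v = 0 := fun v => by
    have := integral_mul_fderiv_eq_neg_fderiv_mul_of_integrable (μ := (volume : Measure ℂ))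
      (f := fun _ : ℂ => (1 : ℂ)) (g := φ) (v := v) (by simp) (by simpa using hi v)
      (by simpa using hφ.1.continuous.integrable_of_hasCompactSupport hφ.2.1)
      (fun _ _ => by fun_prop) (fun z _ => hφ.1.differentiable (by simp) z)
    simpa using this
  unfold dbar
  rw [integral_const_mul, integral_add (hi 1) ((hi _).const_mul _), integral_const_mul, hz, hz]
  simp

theorem HasWeakDbar.of_contDiff {D : Set ℂ} (hD : MeasurableSet D) {ψ : ℂ → ℂ}
    (hψ : ContDiff ℝ ∞ ψ) : HasWeakDbar D ψ (dbar ψ) := by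
  refine ⟨hψ.continuous.locallyIntegrable.locallyIntegrableOn D,
    (continuous_dbar hψ).locallyIntegrable.locallyIntegrableOn D, fun φ hφ => ?_⟩
  have h := integral_dbar_eq_zero (hφ.smooth_mul hψ)
  have e : ∀ z, dbar (fun z => ψ z * φ z) z = ψ z * dbar φ z + dbar ψ z * φ z := fun z =>
    dbar_mul (hψ.differentiable (by simp) z) (hφ.1.differentiable (by simp) z)
  have i1 := integrableOn_mul_of_tsupport_subset
    (hψ.continuous.locallyIntegrable.locallyIntegrableOn D (μ := volume)) (continuous_dbar hφ.1)
    (hasCompactSupport_dbar hφ.2.1) hD ((tsupport_dbar_subset φ).trans hφ.2.2)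
  have i2 := integrableOn_mul_of_tsupport_subset
    ((continuous_dbar hψ).locallyIntegrable.locallyIntegrableOn D (μ := volume)) hφ.1.continuous
    hφ.2.1 hD hφ.2.2
  simp_rw [e] at h
  rw [integral_add i1 i2] at h
  linear_combination h

theorem dbar_eq_zero_of_differentiable {f : ℂ → ℂ} (hf : Differentiable ℂ f) (z : ℂ) :
    dbar f z = 0 := by
  have h : fderiv ℝ f z = (fderiv ℂ f z).restrictScalars ℝ := (hf z).fderiv_restrictScalars ℝ
  have h2 : fderiv ℂ f z Complex.I = Complex.I * fderiv ℂ f z 1 := by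
    rw [← smul_eq_mul, ← map_smul, smul_eq_mul, mul_one]
  simp only [dbar, h, ContinuousLinearMap.coe_restrictScalars', h2]
  linear_combination (1 / 2 * fderiv ℂ f z 1) * Complex.I_mul_I

theorem contDiff_of_entire {f : ℂ → ℂ} (hf : Differentiable ℂ f) : ContDiff ℝ ∞ f :=
  (hf.contDiff (n := ∞)).restrict_scalars ℝ

/-- `e^{T_D A} (z̄ f + g)` with `f` and `g` entire solves the equation. -/
theorem solvesVekuaBitsadze_of_entire {D : Set ℂ} {A : ℂ → ℂ} {q : ℝ≥0∞} (hq : 2 < q)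
    (hDo : IsOpen D) (hDb : Bornology.IsBounded D) (hA : MemLp A q (volume.restrict D))
    {f g : ℂ → ℂ} (hf : Differentiable ℂ f) (hg : Differentiable ℂ g) :
    SolvesVekuaBitsadze D A
      (fun z => Complex.exp (vekuaT D A z) * (conj z * f z + g z)) := by
  have : IsFiniteMeasure (volume.restrict D) := ⟨by simpa using hDb.measure_lt_top⟩
  have hA1 : LocallyIntegrableOn A D := IntegrableOn.locallyIntegrableOn
    (hA.integrable ((by norm_num : (1 : ℝ≥0∞) ≤ 2).trans hq.le))
  have hneg : ∀ z, -vekuaT D (-A) z = vekuaT D A z := fun z => by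
    simp only [vekuaT, Pi.neg_apply, neg_div, integral_neg]; ring
  have key : ∀ v v' : ℂ → ℂ, ContDiff ℝ ∞ v → Continuous v' → (∀ z, dbar v z = v' z) →
      HasWeakDbar D (fun z => Complex.exp (vekuaT D A z) * v z)
        (fun z => A z * (Complex.exp (vekuaT D A z) * v z) +
          Complex.exp (vekuaT D A z) * v' z) := by
    intro v v' hv hv' hvv'
    have h := HasWeakDbar.of_contDiff hDo.measurableSet hv
    rw [funext hvv'] at h
    have hAv : LocallyIntegrableOn (fun z => A z * v z) D :=
      hA1.mul_continuousOn hv.continuous.continuousOn hDo.isLocallyClosed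
    -- The integrating factor for the coefficient `-A` is `e^{T_D A}`; the equation of `v` is
    -- written with `-A v` added and subtracted.
    have h2 : HasWeakDbar D v (fun z => (-A) z * v z + (A z * v z + v' z)) := by
      convert h using 2 with z
      simp only [Pi.neg_apply]; ring
    have h3 := h2.integratingFactor hq hDo hDb hA.neg
      (hAv.add (hv'.locallyIntegrable.locallyIntegrableOn D))
    simp only [hneg] at h3
    convert h3 using 2 with z
    simp only [Pi.add_apply]; ring
  refine ⟨fun z => Complex.exp (vekuaT D A z) * f z, ?_, ?_⟩
  · refine key _ f ((contDiff_conj.mul (contDiff_of_entire hf)).add (contDiff_of_entire hg))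
      hf.continuous fun z => ?_
    have hfd := (contDiff_of_entire hf).differentiable (by simp) z
    have hcd := contDiff_conj.differentiable (by simp) z
    have hgd := (contDiff_of_entire hg).differentiable (by simp) z
    have hadd : dbar (fun z => conj z * f z + g z) z =
        dbar (fun z => conj z * f z) z + dbar g z := by
      simp only [dbar]
      rw [fderiv_fun_add (f := fun z => conj z * f z) (hcd.mul hfd) hgd]
      simp only [add_apply]; ring
    change dbar (fun z => conj z * f z + g z) z = _
    rw [hadd, dbar_mul hcd hfd, dbar_conj, dbar_eq_zero_of_differentiable hf,
      dbar_eq_zero_of_differentiable hg]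
    ring
  · have := key f (fun _ => 0) (contDiff_of_entire hf) continuous_const
      (dbar_eq_zero_of_differentiable hf)
    simpa using this

/-- Solutions become bianalytic on multiplication by `e^{-T_D A}`. -/
theorem SolvesVekuaBitsadze.bianalytic {D : Set ℂ} {A w : ℂ → ℂ} {q : ℝ≥0∞} (hq : 2 < q)
    (hDo : IsOpen D) (hDb : Bornology.IsBounded D) (hA : MemLp A q (volume.restrict D))
    (hw : SolvesVekuaBitsadze D A w) (hwc : ContinuousOn w D) :
    ∃ f g : ℂ → ℂ, DifferentiableOn ℂ f D ∧ DifferentiableOn ℂ g D ∧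
      ∀ z ∈ D, Complex.exp (-vekuaT D A z) * w z = conj z * f z + g z := by
  obtain ⟨u, h1, h2⟩ := hw
  have h2' : HasWeakDbar D u (fun z => A z * u z + 0) := by simpa using h2
  have k1 := h1.integratingFactor hq hDo hDb hA h2.1
  have k2 := h2'.integratingFactor hq hDo hDb hA locallyIntegrableOn_zero
  simp only [mul_zero] at k2
  have hEc : Continuous fun z => Complex.exp (-vekuaT D A z) :=
    Complex.continuous_exp.comp (continuous_vekuaT hq hDb.measure_lt_top.ne hA).neg
  exact bianalytic_of_weak hDo (hEc.continuousOn.mul hwc) k1 k2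

/-! ### Conics that enclose a region -/

theorem not_isBounded_of_ray_subset {S : Set ℂ} {z w : ℂ} (hw : w ≠ 0)
    (h : ∀ t : ℝ, 0 ≤ t → z + t * w ∈ S) :
    ¬ Bornology.IsBounded (connectedComponentIn S z) := by
  intro hb
  have hc : Continuous fun t : ℝ => z + t * w := by fun_prop
  have hsub : (fun t : ℝ => z + t * w) '' Ici 0 ⊆ connectedComponentIn S z :=
    (isPreconnected_Ici.image _ hc.continuousOn).subset_connectedComponentIn
      ⟨0, by simp, by simp⟩ (by rintro _ ⟨t, ht, rfl⟩; exact h t ht)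
  obtain ⟨R, hR⟩ := (hb.subset hsub).subset_closedBall z
  have hw0 : 0 < ‖w‖ := norm_pos_iff.2 hw
  have ht : 0 ≤ (|R| + 1) / ‖w‖ := by positivity
  have := hR ⟨_, ht, rfl⟩
  simp only [mem_closedBall, dist_eq_norm, add_sub_cancel_left, norm_mul, Complex.norm_real,
    Real.norm_eq_abs, abs_of_nonneg ht, div_mul_cancel₀ _ hw0.ne'] at this
  linarith [le_abs_self R]

/-- If the quadratic part were `≤ 0` in some direction, then along that direction or its opposite
the linear term is `≤ 0` too. `Q` would stay negative on a ray from `z`, making the component of `z`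
unbounded. -/
theorem Conic.quadratic_pos {Q : Conic} {z : ℂ} (hz : z ∈ enclosedRegion Q.curve)
    (hneg : Q.eval z.re z.im < 0) {u v : ℝ} (huv : u ≠ 0 ∨ v ≠ 0) :
    0 < Q.a * u ^ 2 + Q.b * u * v + Q.c * v ^ 2 := by
  by_contra! hle
  have main : ∀ u v : ℝ, (u ≠ 0 ∨ v ≠ 0) → Q.a * u ^ 2 + Q.b * u * v + Q.c * v ^ 2 ≤ 0 →
      (2 * Q.a * z.re + Q.b * z.im + Q.d) * u + (Q.b * z.re + 2 * Q.c * z.im + Q.e) * v ≤ 0 →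
      False := by
    intro u v huv hq hL
    refine not_isBounded_of_ray_subset (S := Q.curveᶜ) (z := z) (w := ⟨u, v⟩) ?_ ?_ hz.2
    · intro h
      rw [Complex.ext_iff] at h
      simp only [Complex.zero_re, Complex.zero_im] at h
      exact huv.elim (fun h' => h' h.1) (fun h' => h' h.2)
    · intro t ht
      have e : Q.eval (z + t * (⟨u, v⟩ : ℂ)).re (z + t * (⟨u, v⟩ : ℂ)).im =
          Q.eval z.re z.im + t * ((2 * Q.a * z.re + Q.b * z.im + Q.d) * u +
            (Q.b * z.re + 2 * Q.c * z.im + Q.e) * v) +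
            t ^ 2 * (Q.a * u ^ 2 + Q.b * u * v + Q.c * v ^ 2) := by
        simp [Conic.eval]; ring
      have h1 := mul_nonneg ht (neg_nonneg.2 hL)
      have h2 := mul_nonneg (sq_nonneg t) (neg_nonneg.2 hq)
      simp only [Conic.curve, mem_compl_iff, mem_ofPred_eq]
      rw [e]
      apply ne_of_lt
      linarith
  rcases le_total ((2 * Q.a * z.re + Q.b * z.im + Q.d) * u +
      (Q.b * z.re + 2 * Q.c * z.im + Q.e) * v) 0 with h | h
  · exact main u v huv hle h
  · exact main (-u) (-v) (by simpa using huv) (by linarith) (by linarith)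

theorem Conic.exists_ellipse_of_neg {Q : Conic} (hQc : ¬ Q.IsCircumference) {z₀ : ℂ}
    (hz₀ : z₀ ∈ enclosedRegion Q.curve) (hneg : Q.eval z₀.re z₀.im < 0) :
    ∃ (c p s : ℂ) (κ : ℝ), s ≠ 0 ∧ ‖s‖ < ‖p‖ ∧ κ ≠ 0 ∧ ∀ z : ℂ, Q.eval z.re z.im =
      κ * (‖conj p * (z - c) - s * conj (z - c)‖ ^ 2 - (‖p‖ ^ 2 - ‖s‖ ^ 2) ^ 2) := by
  have ha : 0 < Q.a := by simpa using Q.quadratic_pos hz₀ hneg (u := 1) (v := 0) (by simp)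
  have hΔ : 0 < Q.c - Q.b ^ 2 / (4 * Q.a) := by
    have := Q.quadratic_pos hz₀ hneg (u := -Q.b) (v := 2 * Q.a) (Or.inr (by positivity))
    have h2 : Q.a * (-Q.b) ^ 2 + Q.b * -Q.b * (2 * Q.a) + Q.c * (2 * Q.a) ^ 2 =
        4 * Q.a ^ 2 * (Q.c - Q.b ^ 2 / (4 * Q.a)) := by
      field_simp; ring
    rw [h2] at this
    exact pos_of_mul_pos_right this (by positivity)
  set c' := Q.c - Q.b ^ 2 / (4 * Q.a) with hc'
  set β := Q.b / (2 * Q.a) with hβ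
  set y₀ := -(Q.e - Q.d * β) / (2 * c') with hy₀
  set x₀ := -(Q.b * y₀ + Q.d) / (2 * Q.a) with hx₀
  set K := c' * y₀ ^ 2 + Q.d ^ 2 / (4 * Q.a) - Q.f with hK
  have hsq : ∀ x y : ℝ, Q.eval x y =
      Q.a * ((x - x₀) + β * (y - y₀)) ^ 2 + c' * (y - y₀) ^ 2 - K := fun x y => by
    have e1 : 2 * c' * y₀ = -(Q.e - Q.d * β) := by rw [hy₀]; field_simp
    have e2 : (x - x₀) + β * (y - y₀) = x + β * y + Q.d / (2 * Q.a) := by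
      rw [hx₀, hβ]; field_simp; ring
    have e3 : Q.b = 2 * Q.a * β := by rw [hβ]; field_simp
    have e4 : Q.c = c' + Q.a * β ^ 2 := by rw [hc', hβ]; field_simp; ring
    rw [e2, hK, Conic.eval, e3, e4]
    have : Q.a * (x + β * y + Q.d / (2 * Q.a)) ^ 2 =
        Q.a * (x + β * y) ^ 2 + Q.d * (x + β * y) + Q.d ^ 2 / (4 * Q.a) := by
      field_simp; ring
    rw [this]
    linear_combination y * e1
  have hK0 : 0 < K := by
    rw [hsq] at hneg
    have h1 := mul_nonneg ha.le (sq_nonneg ((z₀.re - x₀) + β * (z₀.im - y₀)))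
    have h2 := mul_nonneg hΔ.le (sq_nonneg (z₀.im - y₀))
    linarith
  set l := √(K / Q.a) with hl
  set n := √(K / c') with hn
  have hl0 : 0 < l := Real.sqrt_pos.2 (by positivity)
  have hn0 : 0 < n := Real.sqrt_pos.2 (by positivity)
  have hl2 : l ^ 2 = K / Q.a := Real.sq_sqrt (by positivity)
  have hn2 : n ^ 2 = K / c' := Real.sq_sqrt (by positivity)
  -- After completing squares the conic is `x - x₀ = l cos θ - β n sin θ`, `y - y₀ = n sin θ`;
  -- writing this as `p η + s η̄` with `η = e^{iθ}` gives these values. In particular `s = 0` only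
  -- for a circumference.
  let p : ℂ := ⟨(l + n) / 2, β * n / 2⟩
  let s : ℂ := ⟨(l - n) / 2, -(β * n / 2)⟩
  have hp : ‖p‖ ^ 2 = ((l + n) / 2) ^ 2 + (β * n / 2) ^ 2 := by
    rw [← Complex.normSq_eq_norm_sq, Complex.normSq_apply]; simp only [p]; ring
  have hs : ‖s‖ ^ 2 = ((l - n) / 2) ^ 2 + (β * n / 2) ^ 2 := by
    rw [← Complex.normSq_eq_norm_sq, Complex.normSq_apply]; simp only [s]; ring
  have hps : ‖p‖ ^ 2 - ‖s‖ ^ 2 = l * n := by rw [hp, hs]; ring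
  refine ⟨⟨x₀, y₀⟩, p, s, Q.a * c' / K, fun h => hQc ?_, ?_, by positivity, fun z => ?_⟩
  · rw [Complex.ext_iff] at h
    simp only [s, Complex.zero_re, Complex.zero_im] at h
    have hln : l = n := by linarith [h.1]
    have hβ0 : β = 0 := by
      have : β * n = 0 := by linarith [h.2]
      exact (mul_eq_zero.1 this).resolve_right hn0.ne'
    have hb : Q.b = 0 := by
      rw [hβ, div_eq_zero_iff] at hβ0
      exact hβ0.resolve_right (by positivity)
    refine ⟨?_, hb⟩
    have : K / Q.a = K / c' := by rw [← hl2, ← hn2, hln]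
    rw [div_eq_div_iff ha.ne' hΔ.ne'] at this
    have h3 := mul_left_cancel₀ hK0.ne' this
    rw [← h3, hc', hb]; simp
  · refine lt_of_pow_lt_pow_left₀ 2 (norm_nonneg _) ?_
    have := mul_pos hl0 hn0
    linarith
  · have e : ‖conj p * (z - ⟨x₀, y₀⟩) - s * conj (z - ⟨x₀, y₀⟩)‖ ^ 2 =
        n ^ 2 * ((z.re - x₀) + β * (z.im - y₀)) ^ 2 + l ^ 2 * (z.im - y₀) ^ 2 := by
      rw [← Complex.normSq_eq_norm_sq, Complex.normSq_apply]
      simp only [p, s, Complex.sub_re, Complex.sub_im, Complex.mul_re, Complex.mul_im,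
        Complex.conj_re, Complex.conj_im]
      ring
    rw [e, hps, hsq, mul_pow, hl2, hn2]
    field_simp

theorem Conic.exists_ellipse {Q : Conic} (hQc : ¬ Q.IsCircumference)
    (hne : (enclosedRegion Q.curve).Nonempty) :
    ∃ (c p s : ℂ) (κ : ℝ), s ≠ 0 ∧ ‖s‖ < ‖p‖ ∧ κ ≠ 0 ∧ ∀ z : ℂ, Q.eval z.re z.im =
      κ * (‖conj p * (z - c) - s * conj (z - c)‖ ^ 2 - (‖p‖ ^ 2 - ‖s‖ ^ 2) ^ 2) := by
  obtain ⟨z₀, hz₀⟩ := hne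
  have h0 : Q.eval z₀.re z₀.im ≠ 0 := hz₀.1
  rcases h0.lt_or_gt with h | h
  · exact Conic.exists_ellipse_of_neg hQc hz₀ h
  let Q' : Conic := ⟨-Q.a, -Q.b, -Q.c, -Q.d, -Q.e, -Q.f⟩
  have he : ∀ x y, Q'.eval x y = -Q.eval x y := fun x y => by
    simp only [Q', Conic.eval]; ring
  have hcurve : Q'.curve = Q.curve := by
    ext z; simp [Conic.curve, he]
  have hQc' : ¬ Q'.IsCircumference := fun h' =>
    hQc ⟨neg_injective h'.1, neg_eq_zero.1 h'.2⟩
  obtain ⟨c, p, s, κ, hs, hp, hκ, hev⟩ := Conic.exists_ellipse_of_neg hQc' (hcurve ▸ hz₀)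
    (by rw [he]; linarith)
  refine ⟨c, p, s, -κ, hs, hp, neg_ne_zero.2 hκ, fun z => ?_⟩
  rw [← neg_neg (Q.eval _ _), ← he, hev]; ring

variable {c p s : ℂ}

theorem isBounded_ellipse (hp : ‖s‖ < ‖p‖) : Bornology.IsBounded (ellipse c p s) := by
  refine (isBounded_closedBall (x := c) (r := ‖p‖ + ‖s‖)).subset fun z hz => ?_
  have h1 : (‖p‖ - ‖s‖) * ‖z - c‖ ≤ ‖conj p * (z - c) - s * conj (z - c)‖ := by
    refine le_trans ?_ (norm_sub_norm_le _ _)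
    simp only [norm_mul, RCLike.norm_conj]
    rw [sub_mul]
  have h2 : (‖p‖ - ‖s‖) * ‖z - c‖ ≤ (‖p‖ - ‖s‖) * (‖p‖ + ‖s‖) := by
    refine (h1.trans (le_of_lt hz)).trans (le_of_eq (by ring))
  rw [mem_closedBall, dist_eq_norm]
  exact le_of_mul_le_mul_left h2 (by linarith)

/-- From an outer point the ray leading away from the centre never meets the curve; from an inner
point a connected set cannot get out without attaining the boundary value. -/
theorem enclosedRegion_eq_ellipse (hp : ‖s‖ < ‖p‖) :
    enclosedRegion {z | ‖conj p * (z - c) - s * conj (z - c)‖ = ‖p‖ ^ 2 - ‖s‖ ^ 2} =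
      ellipse c p s := by
  set N : ℂ → ℝ := fun z => ‖conj p * (z - c) - s * conj (z - c)‖ with hN
  set R := ‖p‖ ^ 2 - ‖s‖ ^ 2 with hR
  have hR0 : 0 < R := by have := norm_nonneg s; nlinarith
  have hNc : Continuous N := by
    refine continuous_norm.comp ((continuous_const.mul (by fun_prop)).sub
      (continuous_const.mul (Complex.continuous_conj.comp (by fun_prop))))
  ext z
  constructor
  · rintro ⟨hz, hb⟩
    by_contra hzE
    have hgt : R < N z := lt_of_le_of_ne (not_lt.1 hzE) (Ne.symm hz)
    refine not_isBounded_of_ray_subset (w := z - c) ?_ (fun t ht => ?_) hb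
    · intro h
      simp only [hN, h, map_zero, mul_zero, sub_zero, norm_zero] at hgt
      linarith
    · have e : N (z + t * (z - c)) = (1 + t) * N z := by
        have h1 : conj p * (z + t * (z - c) - c) - s * conj (z + t * (z - c) - c) =
            ((1 + t : ℝ) : ℂ) * (conj p * (z - c) - s * conj (z - c)) := by
          simp only [map_sub, map_add, map_mul, Complex.conj_ofReal]
          push_cast; ring
        simp only [hN]
        rw [h1, norm_mul, Complex.norm_real, Real.norm_of_nonneg (by linarith)]
      refine ne_of_gt ?_
      change R < N (z + t * (z - c))
      rw [e]; nlinarith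
  · intro hz
    have hzS : z ∈ ({z | N z = R} : Set ℂ)ᶜ := ne_of_lt hz
    refine ⟨hzS, (isBounded_ellipse (c := c) hp).subset fun w hw => ?_⟩
    by_contra hwE
    have hge : R ≤ N w := not_lt.1 hwE
    obtain ⟨x, hx, hxR⟩ := isPreconnected_connectedComponentIn.intermediate_value
      (mem_connectedComponentIn hzS) hw hNc.continuousOn ⟨(le_of_lt hz : N z ≤ R), hge⟩
    exact connectedComponentIn_subset _ _ hx hxR

theorem frontier_ellipse_subset :
    frontier (ellipse c p s) ⊆
      {z | ‖conj p * (z - c) - s * conj (z - c)‖ = ‖p‖ ^ 2 - ‖s‖ ^ 2} :=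
  frontier_lt_subset_eq (by fun_prop) continuous_const

/-- On a conic that is not a circumference, every polynomial agrees with a function
`z̄ f(z) + g(z)`, `f` and `g` entire. -/
theorem Conic.exists_bianalytic_eq {Q : Conic} (hQc : ¬ Q.IsCircumference)
    (P : MvPolynomial (Fin 2) ℂ) :
    ∃ f g : ℂ → ℂ, Differentiable ℂ f ∧ Differentiable ℂ g ∧
      ∀ z ∈ Q.curve, polyEval P z = conj z * f z + g z := by
  -- The coefficient of `z̄²` in `Q`, after substituting `x = (z + z̄) / 2` and `y = -i (z - z̄) /
  -- 2`.
  set α : ℂ := ((Q.a - Q.c : ℝ) : ℂ) / 4 + Complex.I * Q.b / 4 with hα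
  have hα0 : α ≠ 0 := fun h => hQc (by
    rw [Complex.ext_iff] at h
    simp [hα] at h
    exact ⟨by linarith [h.1], h.2⟩)
  let B : ℂ → ℂ := fun z => (Q.a + Q.c) / 2 * z + (Q.d + Complex.I * Q.e) / 2
  let C : ℂ → ℂ := fun z => (Q.a - Q.c - Complex.I * Q.b) / 4 * z ^ 2 +
    (Q.d - Complex.I * Q.e) / 2 * z + Q.f
  have hB : Differentiable ℂ B := by fun_prop
  have hC : Differentiable ℂ C := by fun_prop
  have hre : ∀ z : ℂ, (z.re : ℂ) = (z + conj z) / 2 := fun z => by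
    rw [Complex.add_conj]; push_cast; ring
  have him : ∀ z : ℂ, (z.im : ℂ) = -Complex.I * (z - conj z) / 2 := fun z => by
    rw [Complex.sub_conj]; push_cast; linear_combination (z.im : ℂ) * Complex.I_mul_I
  have hquad : ∀ z ∈ Q.curve, α * conj z ^ 2 + B z * conj z + C z = 0 := fun z hz => by
    have h : ((Q.eval z.re z.im : ℝ) : ℂ) = 0 := by
      rw [show Q.eval z.re z.im = 0 from hz]; simp
    rw [← h, Conic.eval]
    push_cast
    rw [hre, him]
    simp only [hα, B, C]
    push_cast
    linear_combination (-Q.c * (z - conj z) ^ 2 / 4) * Complex.I_mul_I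
  -- the class is closed under multiplication by `z̄` and by entire functions
  have hconj : ∀ f g : ℂ → ℂ, Differentiable ℂ f → Differentiable ℂ g →
      ∃ f' g' : ℂ → ℂ, Differentiable ℂ f' ∧ Differentiable ℂ g' ∧
        ∀ z ∈ Q.curve, conj z * (conj z * f z + g z) = conj z * f' z + g' z := fun f g hf hg => by
    refine ⟨fun z => g z - α⁻¹ * B z * f z, fun z => -(α⁻¹ * C z * f z), by fun_prop, by fun_prop,
      fun z hz => ?_⟩
    have h := hquad z hz
    have h' : conj z ^ 2 = -(α⁻¹ * (B z * conj z + C z)) := by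
      field_simp; linear_combination h
    linear_combination f z * h'
  induction P using MvPolynomial.induction_on with
  | C a =>
    exact ⟨fun _ => 0, fun _ => a, by fun_prop, by fun_prop, fun z _ => by simp [polyEval]⟩
  | add P₁ P₂ h₁ h₂ =>
    obtain ⟨f₁, g₁, hf₁, hg₁, e₁⟩ := h₁
    obtain ⟨f₂, g₂, hf₂, hg₂, e₂⟩ := h₂
    refine ⟨fun z => f₁ z + f₂ z, fun z => g₁ z + g₂ z, by fun_prop, by fun_prop,
      fun z hz => ?_⟩
    have e : polyEval (P₁ + P₂) z = polyEval P₁ z + polyEval P₂ z := by simp [polyEval]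
    rw [e, e₁ z hz, e₂ z hz]; ring
  | mul_X P₀ i h₀ =>
    obtain ⟨f, g, hf, hg, e₀⟩ := h₀
    obtain ⟨f', g', hf', hg', e'⟩ := hconj f g hf hg
    have hX : ∃ a b : ℂ, ∀ z : ℂ, (![(z.re : ℂ), (z.im : ℂ)] : Fin 2 → ℂ) i =
        a * z + b * conj z := by
      fin_cases i
      · exact ⟨1 / 2, 1 / 2, fun z => by simp [hre]; ring⟩
      · exact ⟨-Complex.I / 2, Complex.I / 2, fun z => by simp [him]; ring⟩
    obtain ⟨a, b, hab⟩ := hX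
    refine ⟨fun z => a * z * f z + b * f' z, fun z => a * z * g z + b * g' z, by fun_prop,
      by fun_prop, fun z hz => ?_⟩
    have e : polyEval (P₀ * MvPolynomial.X i) z = polyEval P₀ z * (a * z + b * conj z) := by
      rw [← hab]; simp [polyEval]
    rw [e, e₀ z hz]
    linear_combination b * e' z hz

end

end VekuaBitsadze

/-! ### Existence and uniqueness for the Dirichlet problem. -/

theorem mainTheorem1 (Q : Conic) (hQ : Q.NonDegenerate) (hQc : ¬ Q.IsCircumference)
    (Γ D : Set ℂ) (hΓ : Γ = Q.curve) (hD : D = enclosedRegion Γ) (hDne : D.Nonempty)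
    (P : MvPolynomial (Fin 2) ℂ) (q : ℝ≥0∞) (hq : 2 < q)
    (A : ℂ → ℂ) (hA : MemW1 D q A) :
    ∃ w : ℂ → ℂ,
      IsDirichletSolution D Γ A (fun z => Complex.exp (vekuaT D A z) * polyEval P z) w ∧
      ∀ w' : ℂ → ℂ,
        IsDirichletSolution D Γ A (fun z => Complex.exp (vekuaT D A z) * polyEval P z) w' →
          Set.EqOn w' w (closure D) := by
  obtain ⟨c, p, s, κ, hs, hp, hκ, hev⟩ := Conic.exists_ellipse hQc (by rwa [← hΓ, ← hD])
  have hps : 0 ≤ ‖p‖ ^ 2 - ‖s‖ ^ 2 := by have := norm_nonneg s; nlinarith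
  have hΓN : Γ = {z | ‖(starRingEnd ℂ) p * (z - c) - s * (starRingEnd ℂ) (z - c)‖ =
      ‖p‖ ^ 2 - ‖s‖ ^ 2} := by
    ext z
    rw [hΓ, Conic.curve, Set.mem_ofPred_eq, Set.mem_ofPred_eq, hev, mul_eq_zero,
      or_iff_right hκ, sub_eq_zero, pow_left_inj₀ (norm_nonneg _) hps two_ne_zero]
  have hDE : D = ellipse c p s := by rw [hD, hΓN, enclosedRegion_eq_ellipse hp]
  have hDo : IsOpen D := hDE ▸ isOpen_ellipse
  have hDb : Bornology.IsBounded D := hDE ▸ isBounded_ellipse hp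
  have hfr : frontier D ⊆ Γ := by rw [hDE, hΓN]; exact frontier_ellipse_subset
  have hAq := hA.1
  have hTc : Continuous (vekuaT D A) := continuous_vekuaT hq hDb.measure_lt_top.ne hAq
  obtain ⟨f, g, hf, hg, hfg⟩ := Q.exists_bianalytic_eq hQc P
  have hw : IsDirichletSolution D Γ A (fun z => Complex.exp (vekuaT D A z) * polyEval P z)
      (fun z => Complex.exp (vekuaT D A z) * ((starRingEnd ℂ) z * f z + g z)) := by
    refine ⟨?_, solvesVekuaBitsadze_of_entire hq hDo hDb hAq hf hg, fun z hz => ?_⟩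
    · exact ((Complex.continuous_exp.comp hTc).mul
        ((Complex.continuous_conj.mul hf.continuous).add hg.continuous)).continuousOn
    · simp only [hfg z (hΓ ▸ hz)]
  refine ⟨_, hw, fun w' hw' => ?_⟩
  set w : ℂ → ℂ := fun z => Complex.exp (vekuaT D A z) * ((starRingEnd ℂ) z * f z + g z)
  obtain ⟨f₁, g₁, hf₁, hg₁, e₁⟩ := hw.2.1.bianalytic hq hDo hDb hAq (hw.1.mono subset_closure)
  obtain ⟨f₂, g₂, hf₂, hg₂, e₂⟩ := hw'.2.1.bianalytic hq hDo hDb hAq (hw'.1.mono subset_closure)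
  -- Extension by zero is continuous because both solutions have the same values on `Γ`, which
  -- contains the frontier of `D`.
  let V : ℂ → ℂ := D.indicator fun z => Complex.exp (-vekuaT D A z) * (w' z - w z)
  have hwΓ : ∀ z ∈ Γ, w' z = w z := fun z hz => (hw'.2.2 z hz).trans (hw.2.2 z hz).symm
  have hV : V = 0 := by
    refine bianalytic_eq_zero (c := c) (p := p) (s := s) (f := fun z => f₂ z - f₁ z)
      (g := fun z => g₂ z - g₁ z) hs hp (hDE ▸ hf₂.sub hf₁) (hDE ▸ hg₂.sub hg₁) ?_
      (fun z hz => Set.indicator_of_notMem (by rwa [hDE]) _) (fun z hz => ?_)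
    · refine continuous_indicator (fun z hz => ?_) ?_
      · rw [hwΓ z (hfr hz), sub_self, mul_zero]
      · exact (Complex.continuous_exp.comp hTc.neg).continuousOn.mul (hw'.1.sub hw.1)
    · rw [← hDE] at hz
      simp only [V, Set.indicator_of_mem hz]
      linear_combination e₂ z hz - e₁ z hz
  intro z hz
  by_cases hzD : z ∈ D
  · have h := congrFun hV z
    simp only [V, Set.indicator_of_mem hzD, Pi.zero_apply, mul_eq_zero, Complex.exp_ne_zero,
      false_or] at h
    exact sub_eq_zero.1 h
  · exact hwΓ z (hfr (by rw [hDo.frontier_eq]; exact ⟨hz, hzD⟩))
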